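/- A finite weighted Markov decision process (MDP) of dimension $d$ is a tuple $M=(S,A,\delta,w)$ with finite sets $S$ of states and $A$ of actions, a partial transition function $\delta$ that maps pairs in $S\times A$ to rational probability distributions on $S$, and a weight function $w\colon A\to\mathbb{Z}^d$; for $s\in S$ the set $A(s)$ of actions $a$ for which $\delta(s,a)$ is defined is assumed to be non-empty. A strategy $\sigma$ maps each history in $(SA)^*S$ ending in $s$ to a rational probability distribution on $A$ with support in $A(s)$; together with an initial state $s_{\mathsf{init}}$ it determines a probability measure $\mathbb{P}^{\sigma}_{M,s_{\mathsf{init}}}$ on $(SA)^\omega$. For $T\subseteq S$, $l\in\{1,\dots,d\}$ and a run $\rho=s_1a_1s_2a_2\cdots$, the truncated sum $\mathsf{TS}^T_l(\rho)$ is $\sum_{j=1}^{n-1}w_l(a_j)$ if $s_n$ is the first visited state of $T$, and $\infty$ if $T$ is never visited. The percentile problem for the truncated sum is: given $M$ (with transition probabilities and weights written as fractions and integers), $s_{\mathsf{init}}\in S$ and finitely many constraints consisting of target sets $T_i\subseteq S$, dimensions $l_i\in\{1,\dots,d\}$, value thresholds $v_i\in\mathbb{Q}$ and probability thresholds $\alpha_i\in[0,1]\cap\mathbb{Q}$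 ($1\le i\le q$), decide whether there is a strategy $\sigma$ such that $$\bigwedge_{i=1}^{q}\ \mathbb{P}^{\sigma}_{M,s_{\mathsf{init}}}\big[\mathsf{TS}^{T_i}_{l_i}\le v_i\big]\ \ge\ \alpha_i .$$ **Theorem.** The multi-dimensional ($d>1$) percentile problem for the truncated sum is undecidable for MDPs with both negative and positive weights. It is undecidable already when restricted to $d=4$ and to queries with a unique target set ($T_1=\dots=T_q$). In both cases no algorithm answers correctly on all instances of the class, whatever its behaviour on other inputs. -/

import Mathlib

open MeasureTheory ProbabilityTheory
open scoped NNReal ENNReal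

namespace PercentileMDP

/-! ### Weighted Markov decision processes -/

/-- A rational probability distribution on a finite type. -/
structure RatDist (α : Type) [Fintype α] where
  prob : α → ℚ≥0
  sum_prob : ∑ x, prob x = 1

/-- A rational probability distribution, seen as a probability mass function. -/
noncomputable def RatDist.toPMF {α : Type} [Fintype α] (p : RatDist α) : PMF α :=
  PMF.ofFintype (fun x => ((p.prob x : ℝ≥0) : ℝ≥0∞)) (by
    have h : (∑ x, (p.prob x : ℝ≥0)) = 1 := by exact_mod_cast p.sum_prob
    exact_mod_cast h)

/-- A finite MDP with states `Fin n`, actions `Fin m` and `d`-dimensional integer weights on its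
actions. The transition function is partial: `trans s a = none` means that the action `a` is not
available in `s`. There are no deadlocks. -/
structure WeightedMDP (n m d : ℕ) where
  trans : Fin n → Fin m → Option (RatDist (Fin n))
  deadlockFree : ∀ s, ∃ a, (trans s a).isSome
  weight : Fin m → Fin d → ℤ

variable {n m d : ℕ}

/-- The set `A(s)` of actions that are available in `s`. -/
def WeightedMDP.available (M : WeightedMDP n m d) (s : Fin n) : Set (Fin m) :=
  {a | (M.trans s a).isSome}

/-- A (randomized, history-dependent) strategy: it maps a history `h s` in `(SA)*S`, given by the
list `h` of the earlier state-action pairs and the current state `s`, to a distribution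
on the actions whose support consists of actions available in `s`. -/
structure WeightedMDP.Strategy (M : WeightedMDP n m d) where
  act : List (Fin n × Fin m) → Fin n → RatDist (Fin m)
  support_subset : ∀ h s a, (act h s).prob a ≠ 0 → a ∈ M.available s

/-! ### The probability measure on runs -/

/-- A sequence `s₀ a₀ s₁ a₁ …` in `(SA)^ω`; `ρ k` is the pair `(s_k, a_k)`. -/
abbrev Run (n m : ℕ) : Type := ℕ → Fin n × Fin m

/-- The distribution of the next state. The value for an unavailable action is irrelevant, since
strategies never choose one. -/
noncomputable def WeightedMDP.nextState (M : WeightedMDP n m d) (s : Fin n) (a : Fin m) :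
    PMF (Fin n) :=
  match M.trans s a with
  | some p => p.toPMF
  | none => PMF.pure s

/-- The distribution of the pair (state, action chosen there) when the earlier history is `h` and
the state has distribution `p`. -/
noncomputable def WeightedMDP.Strategy.pairLaw {M : WeightedMDP n m d} (σ : M.Strategy)
    (h : List (Fin n × Fin m)) (p : PMF (Fin n)) : PMF (Fin n × Fin m) :=
  p.bind fun s => (σ.act h s).toPMF.map fun a => (s, a)

/-- The transition kernel from the first `k + 1` pairs of a run to the next pair. -/
noncomputable def WeightedMDP.Strategy.kernel {M : WeightedMDP n m d} (σ : M.Strategy) (k : ℕ) :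
    Kernel (Π _ : Finset.Iic k, Fin n × Fin m) (Fin n × Fin m) :=
  Kernel.ofFunOfCountable fun x =>
    (σ.pairLaw (List.ofFn fun i : Fin (k + 1) => x ⟨i, Finset.mem_Iic.2 (Nat.lt_succ_iff.1 i.2)⟩)
      (M.nextState (x ⟨k, Finset.mem_Iic.2 le_rfl⟩).1
        (x ⟨k, Finset.mem_Iic.2 le_rfl⟩).2)).toMeasure

instance {M : WeightedMDP n m d} (σ : M.Strategy) (k : ℕ) : IsMarkovKernel (σ.kernel k) :=
  ⟨fun x => by unfold WeightedMDP.Strategy.kernel; exact PMF.toMeasure.isProbabilityMeasure _⟩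

/-- The probability measure on runs of `M` started in `s` under the strategy `σ`. -/
noncomputable def WeightedMDP.Strategy.runMeasure {M : WeightedMDP n m d} (σ : M.Strategy)
    (s : Fin n) : Measure (Run n m) :=
  Kernel.trajMeasure (X := fun _ => Fin n × Fin m)
    (σ.pairLaw [] (PMF.pure s)).toMeasure σ.kernel

/-! ### Truncated sum and percentile queries -/

open scoped Classical in
/-- The truncated sum in dimension `l` for the target set `T`: the sum of the weights before the
first visit of `T`, and `∞` if `T` is never visited. -/
noncomputable def WeightedMDP.truncatedSum (M : WeightedMDP n m d) (T : Finset (Fin n)) (l : Fin d)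
    (ρ : Run n m) : WithTop ℚ :=
  if h : ∃ k, (ρ k).1 ∈ T then
    (((∑ j ∈ Finset.range (Nat.find h), M.weight (ρ j).2 l : ℤ) : ℚ) : WithTop ℚ)
  else ⊤

/-- The data of a percentile constraint `ℙ[TS^T_l ≤ v] ≥ α`. -/
structure Constraint (n d : ℕ) where
  target : Finset (Fin n)
  dim : Fin d
  value : ℚ
  prob : ℚ≥0
  prob_le_one : prob ≤ 1

/-- The strategy `σ` satisfies the constraint `c` from the initial state `s`. -/
def WeightedMDP.Strategy.Satisfies {M : WeightedMDP n m d} (σ : M.Strategy) (s : Fin n)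
    (c : Constraint n d) : Prop :=
  (c.prob : ℝ) ≤
    (σ.runMeasure s).real {ρ | M.truncatedSum c.target c.dim ρ ≤ (c.value : WithTop ℚ)}

/-- An instance of the percentile problem for the truncated sum. -/
structure Instance where
  numStates : ℕ
  numActions : ℕ
  numDims : ℕ
  mdp : WeightedMDP numStates numActions numDims
  init : Fin numStates
  query : List (Constraint numStates numDims)

/-- The percentile problem: some strategy satisfies all constraints of the query. -/
def Instance.Satisfiable (I : Instance) : Prop :=
  ∃ σ : I.mdp.Strategy, ∀ c ∈ I.query, σ.Satisfies I.init c

/-- The MDP has both a positive and a negative weight. -/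
def Instance.HasBothSigns (I : Instance) : Prop :=
  (∃ a l, 0 < I.mdp.weight a l) ∧ (∃ a l, I.mdp.weight a l < 0)

/-- All constraints of the query use the same target set. -/
def Instance.UniqueTarget (I : Instance) : Prop :=
  ∃ T, ∀ c ∈ I.query, c.target = T

/-! ### Decidability -/

/-- A rational number is written as numerator and denominator, a distribution as the list of its
values. -/
def RatDist.code (p : RatDist (Fin n)) : List (ℕ × ℕ) :=
  List.ofFn fun s => ((p.prob s).num, (p.prob s).den)

/-- A target set (as a bit vector), a dimension, a value threshold and a probability threshold. -/
abbrev ConstraintCode : Type := List Bool × ℕ × (ℤ × ℕ) × (ℕ × ℕ)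

def Constraint.code (c : Constraint n d) : ConstraintCode :=
  (List.ofFn fun s => decide (s ∈ c.target), c.dim, (c.value.num, c.value.den),
    (c.prob.num, c.prob.den))

/-- Numbers of states, actions and dimensions; the transition table; the table of weights; the
initial state; the list of constraints. -/
abbrev InstanceCode : Type :=
  (ℕ × ℕ × ℕ) × List (List (Option (List (ℕ × ℕ)))) × List (List ℤ) × ℕ × List ConstraintCode

/-- The finite description of an instance that is given to an algorithm. -/
def Instance.code (I : Instance) : InstanceCode :=
  ((I.numStates, I.numActions, I.numDims),
    List.ofFn (fun s => List.ofFn fun a => (I.mdp.trans s a).map RatDist.code),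
    List.ofFn (fun a => List.ofFn (I.mdp.weight a)),
    I.init,
    I.query.map Constraint.code)

/-- The percentile problem for the truncated sum is decidable on a class of instances if some
algorithm answers correctly on every instance of the class (and does anything on other inputs). -/
def DecidableOn (C : Set Instance) : Prop :=
  ∃ f : InstanceCode → Bool, Computable f ∧ ∀ I ∈ C, (f I.code = true ↔ I.Satisfiable)

end PercentileMDP

namespace PercentileMDP

/-! ### Finite Turing machines for partial recursive functions -/

section TuringMachines

open Turing

/-! The halting problem is reduced to the complement of the percentile problem: the constructed
instance is satisfiable exactly when a given computation runs forever. Any decision procedure on the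
classes considered would then decide halting.

A partial recursive function is run by a finite Turing machine (`exists_TM0_of_partrec`), and this
machine by a loop program with three integer counters: one for each half of the tape, read as a
number in base `B`, and one auxiliary counter. A rule iterates its body a guessed number of times
and then tests one counter for zero. The test makes every guess in the simulation unique, so the
program has an infinite computation iff the machine does not halt (`diverges_tapeProgram_iff`).

In the MDP the strategy makes the guesses and the accumulated weights are the counters. When a loop
is left, a fair coin either continues the program or moves to a check state, where every counter
except the tested one can be changed at will before the target is entered. A fourth weight, minus
the sum of the other three, turns "all sums at most 0" into "all counters equal 0". So a check can
succeed iff the tested counter is 0.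

If the strategy succeeds almost surely, then from every situation of positive probability some path
to success exists, and along it both outcomes of each coin again have positive probability. This
yields honest zero tests and a next configuration, hence an infinite computation
(`exists_attains_of_ae_good`, `LoopProgram.diverges_of_attains`). Conversely, following an infinite
computation, each coin toss gives success with probability 1/2, so failure has probability 0
(`ae_good_of_halfway`, `LoopProgram.halfway_node`).

The argument of the function enters only through the weight of one action. All constraints use one
target, value threshold 0 and probability threshold 1, so both undecidability statements follow
together. -/

theorem exists_toPartrec_code {f : ℕ →. ℕ} (hf : Partrec f) :
    ∃ c : ToPartrec.Code, ∀ k, (c.eval [2 ^ k]).Dom ↔ (f k).Dom := by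
  -- Precomposing `f` with a search for the binary logarithm lets the input be `2 ^ k`, whose binary
  -- digits form a block of equal symbols closed by a single one. Other inputs diverge, which is
  -- harmless.
  have hg : Partrec fun n : ℕ =>
      (Nat.rfind fun k => Part.some (decide (2 ^ k = n))).bind f := by
    refine Partrec.bind (Partrec.rfind ?_) (hf.comp Computable.snd).to₂
    have h : PrimrecPred fun p : ℕ × ℕ => 2 ^ p.2 = p.1 :=
      Primrec.eq.comp
        (((Primrec.nat_rec₁ (α := ℕ) 1 (f := fun _ y => 2 * y)
          (Primrec.nat_mul.comp (Primrec.const 2) Primrec.snd).to₂).comp Primrec.snd).of_eq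
          fun p => by
            induction p.2 with
            | zero => rfl
            | succ k ih => exact (congrArg (2 * ·) ih).trans (pow_succ' 2 k).symm)
        Primrec.fst
    exact (h.decide.to_comp.partrec).to₂
  obtain ⟨c, hc⟩ := ToPartrec.Code.exists_code (Nat.Partrec'.part_iff₁.2 hg)
  refine ⟨c, fun k => ?_⟩
  have hk : k ∈ Nat.rfind fun j => Part.some (decide (2 ^ j = 2 ^ k)) := by
    refine Nat.mem_rfind.2 ⟨by simp, fun {m} hm => ?_⟩
    have : (2 : ℕ) ^ m ≠ 2 ^ k := (Nat.pow_lt_pow_right (by norm_num) hm).ne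
    simp [this]
  have := hc ⟨[2 ^ k], rfl⟩
  have e : (Nat.rfind fun j => Part.some (decide (2 ^ j = 2 ^ k))) = Part.some k :=
    Part.eq_some_iff.2 hk
  change c.eval [2 ^ k] = pure <$> ((Nat.rfind fun j => Part.some (decide (2 ^ j = 2 ^ k))).bind f)
    at this
  rw [this, e]
  exact (congrArg (fun p : Part ℕ => p.Dom) (Part.bind_some k f)).to_iff

theorem trList_two_pow (k : ℕ) :
    PartrecToTM2.trList [2 ^ k] = List.replicate k PartrecToTM2.Γ'.bit0 ++
      [PartrecToTM2.Γ'.bit1, PartrecToTM2.Γ'.cons] := by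
  have h : ∀ k : ℕ, ∃ p : PosNum, ((2 ^ k : ℕ) : Num) = Num.pos p ∧
      PartrecToTM2.trPosNum p = List.replicate k PartrecToTM2.Γ'.bit0 ++
        [PartrecToTM2.Γ'.bit1] := by
    intro k
    induction k with
    | zero => exact ⟨1, by simp; rfl, rfl⟩
    | succ k ih =>
      obtain ⟨p, hp, h⟩ := ih
      refine ⟨p.bit0, ?_, by simp [PartrecToTM2.trPosNum, h, List.replicate_succ]⟩
      rw [pow_succ, Nat.cast_mul, hp, mul_comm, Nat.cast_ofNat, two_mul]
      exact Num.bit0_of_bit0 (Num.pos p)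
  obtain ⟨p, hp, h⟩ := h k
  simp [PartrecToTM2.trList, PartrecToTM2.trNat, hp, PartrecToTM2.trNum, h]

theorem trInit_of_reverse {K : Type} [DecidableEq K] {Γ : K → Type} {k : K} {L : List (Γ k)}
    {x y z : Γ k} {n : ℕ} (h : L.reverse = x :: y :: List.replicate n z) :
    TM2to1.trInit k L = (true, Function.update (fun _ => none) k (some x)) ::
      (false, Function.update (fun _ => none) k (some y)) ::
        List.replicate n (false, Function.update (fun _ => none) k (some z)) := by
  unfold TM2to1.trInit
  rw [h]
  exact congrArg (fun l => (true, Function.update (fun _ => none) k (some x)) ::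
      (false, Function.update (fun _ => none) k (some y)) :: l)
    (List.map_replicate (f := fun a => ((false, Function.update (fun _ => none) k (some a)) :
      TM2to1.Γ' K Γ)))

theorem dom_eval_TM0_congr {Γ Λ Λ' : Type} [Inhabited Γ] [Inhabited Λ] [Inhabited Λ']
    {M : TM0.Machine Γ Λ} {M' : TM0.Machine Γ Λ'} {tr : TM0.Cfg Γ Λ → TM0.Cfg Γ Λ' → Prop}
    (H : StateTransition.Respects (TM0.step M) (TM0.step M') tr) {l : List Γ}
    (h : tr (TM0.init l) (TM0.init l)) : (TM0.eval M' l).Dom ↔ (TM0.eval M l).Dom :=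
  StateTransition.tr_eval_dom H h

/-- A Turing machine with finitely many states can be restricted to them. -/
theorem exists_finite_TM0 {Γ Λ : Type} [Inhabited Γ] [Inhabited Λ] (M : TM0.Machine Γ Λ)
    {S : Set Λ} (hS : S.Finite) (ss : TM0.Supports M S) :
    ∃ (Λ' : Type) (_ : Inhabited Λ') (_ : Finite Λ') (M' : TM0.Machine Γ Λ'),
      ∀ l, (TM0.eval M' l).Dom ↔ (TM0.eval M l).Dom := by
  classical
  let i : Inhabited S := ⟨⟨default, ss.1⟩⟩
  -- States outside `S` are never reached, so their image is arbitrary.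
  let g : PointedMap Λ S :=
    ⟨fun q => if h : q ∈ S then ⟨q, h⟩ else default, by simp [ss.1]; rfl⟩
  refine ⟨S, i, hS.to_subtype, M.map ⟨id, rfl⟩ ⟨id, rfl⟩ g Subtype.val, fun l => ?_⟩
  refine dom_eval_TM0_congr (TM0.Machine.map_respects M ⟨id, rfl⟩ ⟨id, rfl⟩ g Subtype.val ss
    (fun x => rfl) fun q hq => by
      change ((if h : q ∈ S then (⟨q, h⟩ : S) else default : S) : Λ) = q
      rw [dif_pos hq]) ⟨ss.1, ?_⟩
  rw [TM0.map_init]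
  congr 1
  exact List.map_id l

/-- A partial recursive function is simulated by a Turing machine with finitely many states and
tape symbols, which gets the argument `k` as a block of `k` equal symbols. -/
theorem exists_TM0_of_partrec {f : ℕ →. ℕ} (hf : Partrec f) :
    ∃ (Γ Λ : Type) (_ : Inhabited Γ) (_ : Finite Γ) (_ : Inhabited Λ) (_ : Finite Λ)
      (M : TM0.Machine Γ Λ) (a b c : Γ),
      ∀ k, (TM0.eval M (a :: b :: List.replicate k c)).Dom ↔ (f k).Dom := by
  obtain ⟨u, hu⟩ := exists_toPartrec_code hf
  -- The default label is the one where the machine starts, so it has to be the entry point of `u`.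
  let iΛ : Inhabited PartrecToTM2.Λ' := ⟨PartrecToTM2.trNormal u PartrecToTM2.Cont'.halt⟩
  have : Fintype PartrecToTM2.K' := ⟨{.main, .rev, .aux, .stack}, fun k => by cases k <;> simp⟩
  let Γ := TM2to1.Γ' PartrecToTM2.K' fun _ => PartrecToTM2.Γ'
  have ss := TM1to0.tr_supports _ (TM2to1.tr_supports PartrecToTM2.tr
    (PartrecToTM2.tr_supports u PartrecToTM2.Cont'.halt))
  obtain ⟨Λ', i, fi, M', hM'⟩ := exists_finite_TM0 _ (Finset.finite_toSet _) ss
  let sym : PartrecToTM2.Γ' → PartrecToTM2.K' → Option PartrecToTM2.Γ' := fun x =>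
    Function.update (fun _ => none) PartrecToTM2.K'.main (some x)
  -- The tape lists the main stack from its bottom (marked by `true`): the separator, the leading
  -- bit of `2 ^ k`, then its `k` zero bits.
  refine ⟨Γ, Λ', inferInstance, inferInstance, i, fi, M', (true, sym .cons), (false, sym .bit1),
    (false, sym .bit0), fun k => ?_⟩
  rw [hM', ← hu k, TM1to0.tr_eval]
  have e : ((true, sym .cons) :: (false, sym .bit1) :: List.replicate k (false, sym .bit0) : List Γ)
      = TM2to1.trInit PartrecToTM2.K'.main (PartrecToTM2.trList [2 ^ k]) :=
    (trInit_of_reverse (Γ := fun _ => PartrecToTM2.Γ') (by rw [trList_two_pow]; simp)).symm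
  rw [e]
  refine (TM2to1.tr_eval_dom PartrecToTM2.tr _ _).trans ?_
  have h2 : TM2.init (Γ := fun _ => PartrecToTM2.Γ') (σ := Option PartrecToTM2.Γ')
      PartrecToTM2.K'.main (PartrecToTM2.trList [2 ^ k]) = PartrecToTM2.init u [2 ^ k] := by
    unfold TM2.init PartrecToTM2.init
    congr 1
    funext x
    cases x <;> rfl
  unfold TM2.eval
  rw [h2, PartrecToTM2.tr_eval]
  exact Iff.rfl

end TuringMachines

/-! ### Loop programs -/

/-- A nondeterministic program over counters indexed by `C`. The execution of a rule adds `pre` to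
the counters and then adds `body` any number of times; afterwards the counter `test` has to
vanish. -/
structure LoopProgram (N R C : Type) where
  src : R → N
  dst : R → N
  pre : R → C → ℤ
  body : R → C → ℤ
  test : R → C

namespace LoopProgram

variable {N R C : Type}

def Step (P : LoopProgram N R C) (c c' : N × (C → ℤ)) : Prop :=
  ∃ (r : R) (k : ℕ), P.src r = c.1 ∧ P.dst r = c'.1 ∧
    c'.2 = c.2 + P.pre r + k • P.body r ∧ c'.2 (P.test r) = 0

/-- The program has an infinite computation from `c`. -/
def Diverges (P : LoopProgram N R C) (c : N × (C → ℤ)) : Prop :=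
  ∃ X : Set (N × (C → ℤ)), c ∈ X ∧ ∀ c ∈ X, ∃ c' ∈ X, P.Step c c'

end LoopProgram

/-! ### Turing machines as loop programs -/

open Turing

/-- The node keeps the scanned symbol; the counters hold only the two half-tapes. A head move passes
through `pushed`, `stored` and `popped`; a halted machine goes to `dead`, which has no rule. -/
inductive TapeNode (Γ Λ : Type) : Type
  | start
  | dead
  | main (q : Λ) (a : Γ)
  | pushed (d : Dir) (q : Λ)
  | stored (d : Dir) (q : Λ)
  | popped (d : Dir) (q : Λ) (a : Γ)

inductive TapeRule (Γ Λ : Type) : Type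
  | start
  | main (q : Λ) (a : Γ)
  | store (d : Dir) (q : Λ)
  | pop (d : Dir) (q : Λ) (a : Γ)
  | restore (d : Dir) (q : Λ) (a : Γ)

instance : Fintype Dir := ⟨{.left, .right}, fun d => by cases d <;> simp⟩

instance {Γ Λ : Type} [Finite Γ] [Finite Λ] : Finite (TapeNode Γ Λ) :=
  Finite.of_injective (β := Option (Option (Λ × Γ ⊕ Dir × Λ ⊕ Dir × Λ ⊕ Dir × Λ × Γ)))
    (fun
      | .start => none
      | .dead => some none
      | .main q a => some (some (.inl (q, a)))
      | .pushed d q => some (some (.inr (.inl (d, q))))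
      | .stored d q => some (some (.inr (.inr (.inl (d, q)))))
      | .popped d q a => some (some (.inr (.inr (.inr (d, q, a))))))
    fun x y => by cases x <;> cases y <;> simp

instance {Γ Λ : Type} [Finite Γ] [Finite Λ] : Finite (TapeRule Γ Λ) :=
  Finite.of_injective (β := Option (Λ × Γ ⊕ Dir × Λ ⊕ Dir × Λ × Γ ⊕ Dir × Λ × Γ))
    (fun
      | .start => none
      | .main q a => some (.inl (q, a))
      | .store d q => some (.inr (.inl (d, q)))
      | .pop d q a => some (.inr (.inr (.inl (d, q, a))))
      | .restore d q a => some (.inr (.inr (.inr (d, q, a)))))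
    fun x y => by cases x <;> cases y <;> simp

/-- The opposite direction. -/
def opp : Dir → Dir
  | .left => .right
  | .right => .left

/-- The counters with value `x` on the side `d`, value `y` on the other side, and the auxiliary
counter `z`. -/
def tapeVec (d : Dir) (x y z : ℤ) : Option Dir → ℤ
  | none => z
  | some d' => if d' = d then x else y

theorem tapeVec_opp (d : Dir) (x y z : ℤ) : tapeVec (opp d) x y z = tapeVec d y x z := by
  funext i
  rcases i with _ | _ | _ <;> cases d <;> simp [tapeVec, opp]

/-- The loop program that simulates a Turing machine. The two sides of the tape are numbers in
base `B`, with digits given by `e`; the right side is initially `n`. -/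
def tapeProgram {Γ Λ : Type} [Inhabited Λ] (M : TM0.Machine Γ Λ) (B : ℕ) (e : Γ → ℕ) (a₀ : Γ)
    (n : ℕ) : LoopProgram (TapeNode Γ Λ) (TapeRule Γ Λ) (Option Dir) where
  src
    | .start => .start
    | .main q a => .main q a
    | .store d q => .pushed d q
    | .pop d q _ => .stored d q
    | .restore d q a => .popped d q a
  dst
    | .start => .main default a₀
    | .main q a => match M q a with
      | none => .dead
      | some (q', .write b) => .main q' b
      | some (q', .move d) => .pushed d q'
    | .store d q => .stored d q
    | .pop d q a => .popped d q a
    | .restore _ q a => .main q a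
  pre
    | .start => tapeVec .right n 0 0
    | .main q a => match M q a with
      | some (_, .move _) => tapeVec .right 0 0 (e a)
      | _ => 0
    | .pop d _ a => tapeVec d (-e a) 0 0
    | _ => 0
  body
    | .start => 0
    | .main q a => match M q a with
      | some (_, .move d) => tapeVec d 0 (-1) B
      | _ => 0
    | .store d _ => tapeVec d 0 1 (-1)
    | .pop d _ _ => tapeVec d (-B) 0 1
    | .restore d _ _ => tapeVec d 1 0 (-1)
  test
    | .start => none
    | .main q a => match M q a with
      | some (_, .move d) => some (opp d)
      | _ => none
    | .store _ _ => none
    | .pop d _ _ => some d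
    | .restore _ _ _ => none

theorem tapeVec_ext_iff {d : Dir} {v : Option Dir → ℤ} {x y z : ℤ} :
    v = tapeVec d x y z ↔ v (some d) = x ∧ v (some (opp d)) = y ∧ v none = z := by
  constructor
  · rintro rfl
    cases d <;> simp [tapeVec, opp]
  · rintro ⟨rfl, rfl, rfl⟩
    funext i
    rcases i with _ | _ | _ <;> cases d <;> simp [tapeVec, opp]

@[simp] theorem tapeVec_none (d : Dir) (x y z : ℤ) : tapeVec d x y z none = z := rfl

@[simp] theorem tapeVec_self (d : Dir) (x y z : ℤ) : tapeVec d x y z (some d) = x := by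
  simp [tapeVec]

@[simp] theorem tapeVec_some_opp (d : Dir) (x y z : ℤ) : tapeVec d x y z (some (opp d)) = y := by
  cases d <;> simp [tapeVec, opp]

/-! ### Correctness of the simulation -/

section Simulation

variable {Γ Λ : Type} [Inhabited Λ] {M : TM0.Machine Γ Λ} {B : ℕ} {e : Γ → ℕ} {a₀ : Γ} {n : ℕ}

theorem tapeVec_right_eq (d : Dir) (z : ℤ) : tapeVec .right 0 0 z = tapeVec d 0 0 z := by
  cases d
  · exact tapeVec_opp .left 0 0 z
  · rfl

theorem step_start {c : TapeNode Γ Λ × (Option Dir → ℤ)} :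
    (tapeProgram M B e a₀ n).Step (.start, 0) c ↔
      c = (.main default a₀, tapeVec .right n 0 0) := by
  obtain ⟨p, v⟩ := c
  constructor
  · rintro ⟨r, k, h1, h2, h3, h4⟩
    cases r <;> simp only [tapeProgram, reduceCtorEq] at h1
    simp only [tapeProgram] at h2 h3
    simp [← h2, h3]
  · rintro ⟨⟩
    exact ⟨.start, 0, by simp [tapeProgram]⟩

theorem not_step_dead {v} {c : TapeNode Γ Λ × (Option Dir → ℤ)} :
    ¬ (tapeProgram M B e a₀ n).Step (.dead, v) c := by
  rintro ⟨r, k, h1, -⟩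
  cases r <;> simp [tapeProgram] at h1

theorem step_halt {q a v} {c : TapeNode Γ Λ × (Option Dir → ℤ)} (h : M q a = none)
    (hc : (tapeProgram M B e a₀ n).Step (.main q a, v) c) : c.1 = .dead := by
  obtain ⟨r, k, h1, h2, -⟩ := hc
  cases r <;> simp only [tapeProgram, reduceCtorEq, TapeNode.main.injEq] at h1
  obtain ⟨rfl, rfl⟩ := h1
  simpa [tapeProgram, h] using h2.symm

theorem step_write {q a q' b d} {x y : ℤ} {c : TapeNode Γ Λ × (Option Dir → ℤ)}
    (h : M q a = some (q', .write b)) :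
    (tapeProgram M B e a₀ n).Step (.main q a, tapeVec d x y 0) c ↔
      c = (.main q' b, tapeVec d x y 0) := by
  obtain ⟨p, v⟩ := c
  constructor
  · rintro ⟨r, k, h1, h2, h3, h4⟩
    cases r <;> simp only [tapeProgram, reduceCtorEq, TapeNode.main.injEq] at h1
    obtain ⟨rfl, rfl⟩ := h1
    simp only [tapeProgram, h] at h2 h3
    simp [← h2, h3]
  · rintro ⟨⟩
    exact ⟨.main q a, 0, by simp [tapeProgram, h]⟩

/-- Each iteration moves one unit of the counter behind the head into `B` units of the auxiliary
counter, so the zero test forces exactly `y` iterations. The scanned symbol becomes the new lowest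
digit. -/
theorem step_push {q a q' d} {x : ℤ} {y : ℕ} {c : TapeNode Γ Λ × (Option Dir → ℤ)}
    (h : M q a = some (q', .move d)) :
    (tapeProgram M B e a₀ n).Step (.main q a, tapeVec d x y 0) c ↔
      c = (.pushed d q', tapeVec d x 0 (B * y + e a)) := by
  obtain ⟨p, v⟩ := c
  constructor
  · rintro ⟨r, k, h1, h2, h3, h4⟩
    cases r <;> simp only [tapeProgram, reduceCtorEq, TapeNode.main.injEq] at h1
    obtain ⟨rfl, rfl⟩ := h1
    simp only [tapeProgram, h] at h2 h3 h4
    subst h3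
    rw [tapeVec_right_eq d] at h4 ⊢
    simp at h4
    rw [Prod.mk.injEq, tapeVec_ext_iff]
    refine ⟨h2.symm, by simp, by simpa using h4, ?_⟩
    simp
    have : (y : ℤ) = k := by linarith
    rw [this]; ring
  · rintro ⟨⟩
    refine ⟨.main q a, y, by simp [tapeProgram], by simp [tapeProgram, h], ?_, by
      simp [tapeProgram, h]⟩
    simp only [tapeProgram, h]
    rw [tapeVec_right_eq d]
    symm
    rw [tapeVec_ext_iff]
    refine ⟨by simp, by simp, ?_⟩
    simp
    ring

theorem step_store {q d} {x : ℤ} {z : ℕ} {c : TapeNode Γ Λ × (Option Dir → ℤ)} :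
    (tapeProgram M B e a₀ n).Step (.pushed d q, tapeVec d x 0 z) c ↔
      c = (.stored d q, tapeVec d x z 0) := by
  obtain ⟨p, v⟩ := c
  constructor
  · rintro ⟨r, k, h1, h2, h3, h4⟩
    cases r <;> simp only [tapeProgram, reduceCtorEq, TapeNode.pushed.injEq] at h1
    obtain ⟨rfl, rfl⟩ := h1
    simp only [tapeProgram] at h2 h3 h4
    subst h3
    simp at h4
    rw [Prod.mk.injEq, tapeVec_ext_iff]
    refine ⟨h2.symm, by simp, ?_, by simpa using h4⟩
    simp
    linarith
  · rintro ⟨⟩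
    refine ⟨.store d q, z, by simp [tapeProgram], by simp [tapeProgram], ?_, by
      simp [tapeProgram]⟩
    simp only [tapeProgram]
    symm
    rw [tapeVec_ext_iff]
    refine ⟨by simp, by simp, by simp⟩

/-- Division with remainder: subtracting a guessed digit and then multiples of `B` ends at 0 only if
the digit is the remainder and the number of iterations is the quotient. -/
theorem step_pop {q d} {x : ℕ} {y : ℤ} {c : TapeNode Γ Λ × (Option Dir → ℤ)}
    (he : ∀ a, e a < B) :
    (tapeProgram M B e a₀ n).Step (.stored d q, tapeVec d x y 0) c ↔
      ∃ a, e a = x % B ∧ c = (.popped d q a, tapeVec d 0 y (x / B : ℕ)) := by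
  obtain ⟨p, v⟩ := c
  constructor
  · rintro ⟨r, k, h1, h2, h3, h4⟩
    cases r with
    | pop d q a =>
      simp only [tapeProgram, TapeNode.stored.injEq] at h1
      obtain ⟨rfl, rfl⟩ := h1
      simp only [tapeProgram] at h2 h3 h4
      subst h3
      simp at h4
      have hx : x = e a + B * k := by
        zify
        linarith
      refine ⟨a, by rw [hx, Nat.add_mul_mod_self_left, Nat.mod_eq_of_lt (he a)], ?_⟩
      rw [Prod.mk.injEq, tapeVec_ext_iff]
      refine ⟨h2.symm, by simpa using h4, by simp, ?_⟩
      have hB : 0 < B := (Nat.zero_le _).trans_lt (he a)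
      rw [hx, Nat.add_mul_div_left _ _ hB, Nat.div_eq_of_lt (he a)]
      simp
    | _ => simp only [tapeProgram, reduceCtorEq] at h1
  · rintro ⟨a, ha, ⟨⟩⟩
    have hx : (x : ℤ) = e a + B * (x / B : ℕ) := by
      rw [ha]
      exact_mod_cast (Nat.mod_add_div x B).symm
    generalize x / B = k at hx ⊢
    refine ⟨.pop d q a, k, by simp [tapeProgram], by simp [tapeProgram], ?_, by
      simp [tapeProgram]⟩
    simp only [tapeProgram]
    symm
    rw [tapeVec_ext_iff]
    refine ⟨?_, by simp, by simp⟩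
    simp
    linarith

theorem step_restore {q d a} {y : ℤ} {z : ℕ} {c : TapeNode Γ Λ × (Option Dir → ℤ)} :
    (tapeProgram M B e a₀ n).Step (.popped d q a, tapeVec d 0 y z) c ↔
      c = (.main q a, tapeVec d z y 0) := by
  obtain ⟨p, v⟩ := c
  constructor
  · rintro ⟨r, k, h1, h2, h3, h4⟩
    cases r <;> simp only [tapeProgram, reduceCtorEq, TapeNode.popped.injEq] at h1
    obtain ⟨rfl, rfl, rfl⟩ := h1
    simp only [tapeProgram] at h2 h3 h4
    subst h3
    simp at h4
    rw [Prod.mk.injEq, tapeVec_ext_iff]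
    refine ⟨h2.symm, ?_, by simp, by simpa using h4⟩
    simp
    linarith
  · rintro ⟨⟩
    refine ⟨.restore d q a, z, by simp [tapeProgram], by simp [tapeProgram], ?_, by
      simp [tapeProgram]⟩
    simp only [tapeProgram]
    symm
    rw [tapeVec_ext_iff]
    refine ⟨by simp, by simp, by simp⟩

/-! ### Tapes as pairs of numbers in base `B` -/

variable [Inhabited Γ]

/-- `x` is the number in base `B` whose digits are given by the symbols of `L`. -/
def IsCode (B : ℕ) (e : Γ → ℕ) (x : ℕ) (L : ListBlank Γ) : Prop :=
  ∀ i, e (L.nth i) = x / B ^ i % B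

theorem IsCode.head {x : ℕ} {L : ListBlank Γ} (h : IsCode B e x L) : e L.head = x % B := by
  simpa using h 0

theorem IsCode.tail {x : ℕ} {L : ListBlank Γ} (h : IsCode B e x L) :
    IsCode B e (x / B) L.tail := fun i => by
  rw [← ListBlank.nth_succ, h, Nat.div_div_eq_div_mul, pow_succ']

theorem IsCode.cons {x : ℕ} {L : ListBlank Γ} (h : IsCode B e x L) (he : ∀ a, e a < B) (a : Γ) :
    IsCode B e (B * x + e a) (L.cons a) := fun i => by
  cases i with
  | zero => simp [Nat.mod_eq_of_lt (he a)]
  | succ i =>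
    have hB : 0 < B := (Nat.zero_le _).trans_lt (he a)
    rw [ListBlank.nth_succ, ListBlank.tail_cons, h, pow_succ', ← Nat.div_div_eq_div_mul,
      Nat.mul_add_div hB, Nat.div_eq_of_lt (he a), add_zero]

theorem IsCode.nil (h : e default = 0) : IsCode B e 0 (ListBlank.mk []) := fun i => by
  simp [ListBlank.nth_mk, h]

/-- The half of the tape on the given side of the head. -/
def side (T : Tape Γ) : Dir → ListBlank Γ
  | .left => T.left
  | .right => T.right

/-- A configuration of the loop program represents a configuration of the Turing machine. -/
def Represents (B : ℕ) (e : Γ → ℕ) (C : TM0.Cfg Γ Λ) (c : TapeNode Γ Λ × (Option Dir → ℤ)) :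
    Prop :=
  c.1 = .main C.q C.Tape.head ∧ ∃ x : Dir → ℕ, c.2 = tapeVec .right (x .right) (x .left) 0 ∧
    ∀ d, IsCode B e (x d) (side C.Tape d)

theorem tapeVec_right_apply (x : Dir → ℕ) (d : Dir) (z : ℤ) :
    tapeVec .right (x .right) (x .left) z = tapeVec d (x d) (x (opp d)) z := by
  cases d
  · exact tapeVec_opp .left _ _ z
  · rfl

theorem represents_move {q' : Λ} {T : Tape Γ} {x : Dir → ℕ} (he : ∀ a, e a < B)
    (hx : ∀ d, IsCode B e (x d) (side T d)) (d : Dir) :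
    Represents B e ⟨q', T.move d⟩ (.main q' (side T d).head,
      tapeVec d (x d / B : ℕ) (B * x (opp d) + e T.head : ℕ) 0) := by
  -- The half-tape ahead loses its lowest digit; the one behind gains the old head symbol.
  let x' : Dir → ℕ := fun d' => if d' = d then x d / B else B * x (opp d) + e T.head
  have hd : x' d = x d / B := by simp [x']
  have ho : x' (opp d) = B * x (opp d) + e T.head := by cases d <;> simp [x', opp]
  refine ⟨by cases d <;> rfl, x', ?_, fun d' => ?_⟩
  · rw [← hd, ← ho]
    exact (tapeVec_right_apply x' d 0).symm
  · by_cases h : d' = d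
    · subst h
      rw [hd]
      cases d' <;> exact (hx _).tail
    · have : d' = opp d := by cases d <;> cases d' <;> simp_all [opp]
      subst this
      rw [ho]
      cases d <;> exact (hx _).cons he _

theorem Represents.exists_step {C C' : TM0.Cfg Γ Λ} {c} (h : Represents B e C c)
    (he : ∀ a, e a < B) (hs : TM0.step M C = some C') :
    ∃ c', Relation.TransGen (tapeProgram M B e a₀ n).Step c c' ∧ Represents B e C' c' := by
  obtain ⟨p, v⟩ := c
  obtain ⟨q, T⟩ := C
  obtain ⟨hp, x, hv, hx⟩ := h
  simp only at hp hv
  subst hp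
  subst hv
  simp only [TM0.step, Option.map_eq_some_iff] at hs
  obtain ⟨⟨q', s⟩, hM, rfl⟩ := hs
  cases s with
  | write b =>
    exact ⟨_, .single ((step_write hM).2 rfl), rfl, x, rfl, fun d => by cases d <;> exact hx _⟩
  | move d =>
    rw [tapeVec_right_apply x d]
    refine ⟨_, ?_, represents_move he hx d⟩
    have h₁ := (step_push (B := B) (e := e) (a₀ := a₀) (n := n) (x := x d) (y := x (opp d)) hM).2 rfl
    have h₂ := (step_store (M := M) (B := B) (e := e) (a₀ := a₀) (n := n) (q := q') (d := d)
      (x := x d) (z := B * x (opp d) + e T.head)).2 rfl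
    have h₃ := (step_pop (M := M) (B := B) (e := e) (a₀ := a₀) (n := n) (q := q') (d := d)
      (x := x d) (y := (B * x (opp d) + e T.head : ℕ)) he).2 ⟨_, (hx d).head, rfl⟩
    push_cast at h₂
    exact .tail (.tail (.tail (.single h₁) h₂) (by exact_mod_cast h₃)) (step_restore.2 rfl)

/-- From a representing configuration every program step is forced, so a set closed under having a
successor cannot avoid the next representing configuration. -/
theorem Represents.exists_mem {C C' : TM0.Cfg Γ Λ} {c} (h : Represents B e C c)
    (he : ∀ a, e a < B) (hinj : Function.Injective e) (hs : TM0.step M C = some C')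
    {X : Set (TapeNode Γ Λ × (Option Dir → ℤ))}
    (hX : ∀ c ∈ X, ∃ c' ∈ X, (tapeProgram M B e a₀ n).Step c c') (hc : c ∈ X) :
    ∃ c' ∈ X, Represents B e C' c' := by
  obtain ⟨p, v⟩ := c
  obtain ⟨q, T⟩ := C
  obtain ⟨hp, x, hv, hx⟩ := h
  simp only at hp hv
  subst hp
  subst hv
  simp only [TM0.step, Option.map_eq_some_iff] at hs
  obtain ⟨⟨q', s⟩, hM, rfl⟩ := hs
  obtain ⟨c₁, h₁, hs₁⟩ := hX _ hc
  cases s with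
  | write b =>
    rw [step_write hM] at hs₁
    subst hs₁
    exact ⟨_, h₁, rfl, x, rfl, fun d => by cases d <;> exact hx _⟩
  | move d =>
    rw [tapeVec_right_apply x d, step_push hM] at hs₁
    subst hs₁
    obtain ⟨c₂, h₂, hs₂⟩ := hX _ h₁
    have hz : (B * (x (opp d)) + e T.head : ℤ) = ((B * x (opp d) + e T.head : ℕ) : ℤ) := by
      push_cast; rfl
    rw [hz, step_store] at hs₂
    subst hs₂
    obtain ⟨c₃, h₃, hs₃⟩ := hX _ h₂
    obtain ⟨a, ha, rfl⟩ := (step_pop he).1 hs₃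
    -- Distinct symbols have distinct digits, so the guessed symbol is the one on the tape.
    obtain rfl : a = (side T d).head := hinj (ha.trans (hx d).head.symm)
    obtain ⟨c₄, h₄, hs₄⟩ := hX _ h₃
    rw [step_restore] at hs₄
    subst hs₄
    exact ⟨_, h₄, represents_move he hx d⟩

theorem diverges_tapeProgram_iff (he : ∀ a, e a < B) (hinj : Function.Injective e)
    (h0 : e default = 0) {l : List Γ} (hn : IsCode B e n (ListBlank.mk l)) :
    (tapeProgram M B e a₀ n).Diverges (.start, 0) ↔ ¬ (TM0.eval M (a₀ :: l)).Dom := by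
  have hdom : (TM0.eval M (a₀ :: l)).Dom ↔
      ∃ C, StateTransition.Reaches (TM0.step M) (TM0.init (a₀ :: l)) C ∧ TM0.step M C = none := by
    refine (show _ ↔ (StateTransition.eval (TM0.step M) _).Dom from Iff.rfl).trans ?_
    exact Part.dom_iff_mem.trans (exists_congr fun C => StateTransition.mem_eval)
  have hinit : Represents B e (TM0.init (a₀ :: l) : TM0.Cfg Γ Λ)
      (.main default a₀, tapeVec .right n 0 0) := by
    refine ⟨rfl, fun | .right => n | .left => 0, rfl, fun d => ?_⟩
    cases d
    · exact IsCode.nil h0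
    · exact hn
  rw [hdom]
  constructor
  · rintro ⟨X, hc, hX⟩ ⟨C, hC, hC'⟩
    have key : ∃ c ∈ X, Represents B e C c := by
      clear hC'
      induction hC with
      | refl =>
        obtain ⟨c, hcX, hs⟩ := hX _ hc
        rw [step_start] at hs
        exact ⟨c, hcX, hs ▸ hinit⟩
      | tail _ hs ih =>
        obtain ⟨c, hcX, hr⟩ := ih
        exact hr.exists_mem he hinj hs hX hcX
    obtain ⟨⟨p, v⟩, hcX, rfl, -⟩ := key
    -- A halted configuration can step only to `dead`, which has no successor; this contradicts the
    -- closure property of `X`.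
    obtain ⟨⟨p', v'⟩, hX', hs⟩ := hX _ hcX
    have hM : M C.q C.Tape.head = none := by
      simpa [TM0.step] using hC'
    obtain rfl : p' = .dead := step_halt hM hs
    obtain ⟨c, -, hd⟩ := hX _ hX'
    exact not_step_dead hd
  · intro hdiv
    -- The set contains every configuration that leads to a representation of a reachable machine
    -- configuration, which covers the intermediate phases of a move.
    refine ⟨{c | ∃ C c', StateTransition.Reaches (TM0.step M) (TM0.init (a₀ :: l)) C ∧
      Represents B e C c' ∧ Relation.ReflTransGen (tapeProgram M B e a₀ n).Step c c'},
      ⟨_, _, .refl, hinit, .single (step_start.2 rfl)⟩, ?_⟩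
    rintro c ⟨C, c', hC, hr, hs⟩
    rcases hs.cases_head with rfl | ⟨c₁, h₁, h₂⟩
    · obtain ⟨C', hC'⟩ : ∃ C', TM0.step M C = some C' :=
        Option.ne_none_iff_exists'.1 fun h => hdiv ⟨C, hC, h⟩
      obtain ⟨c₂, h₂, hr₂⟩ := hr.exists_step (a₀ := a₀) (n := n) he hC'
      obtain ⟨c₁, h₁, h₁₂⟩ := Relation.TransGen.head'_iff.1 h₂
      exact ⟨c₁, ⟨C', c₂, hC.tail hC', hr₂, h₁₂⟩, h₁⟩
    · exact ⟨c₁, ⟨C, c', hC, hr, h₂⟩, h₁⟩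

end Simulation

variable {n m d : ℕ}

/-! ### Probabilities of cylinder sets -/

/-- The first `k` state-action pairs of a run. -/
def Run.take (ρ : Run n m) (k : ℕ) : List (Fin n × Fin m) :=
  List.ofFn fun i : Fin k => ρ i

theorem Run.take_succ (ρ : Run n m) (k : ℕ) : Run.take ρ (k + 1) = Run.take ρ k ++ [ρ k] := by
  rw [Run.take, List.ofFn_succ', List.concat_eq_append]
  rfl

@[simp] theorem Run.length_take (ρ : Run n m) (k : ℕ) : (Run.take ρ k).length = k := by
  simp [Run.take]

/-- The runs that start with the history `h`. -/
def cyl (h : List (Fin n × Fin m)) : Set (Run n m) := {ρ | Run.take ρ h.length = h}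

/-- The runs that start with the history `h` and then visit the state `s`. -/
def cylState (h : List (Fin n × Fin m)) (s : Fin n) : Set (Run n m) :=
  {ρ | ρ ∈ cyl h ∧ (ρ h.length).1 = s}

theorem cyl_nil : cyl ([] : List (Fin n × Fin m)) = Set.univ := by
  ext ρ
  simp [cyl, Run.take]

theorem mem_cyl_append {h : List (Fin n × Fin m)} {p : Fin n × Fin m} {ρ : Run n m} :
    ρ ∈ cyl (h ++ [p]) ↔ ρ ∈ cyl h ∧ ρ h.length = p := by
  simp only [cyl, Set.mem_ofPred_eq, List.length_append, List.length_singleton, Run.take_succ]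
  exact ⟨fun h' => by simpa using List.append_inj' h' rfl, fun ⟨h1, h2⟩ => by rw [h1, h2]⟩

theorem measurableSet_cyl (h : List (Fin n × Fin m)) : MeasurableSet (cyl h) := by
  induction h using List.reverseRecOn with
  | nil => simp [cyl_nil]
  | append_singleton h p ih =>
    have : cyl (h ++ [p]) = cyl h ∩ (fun ρ : Run n m => ρ h.length) ⁻¹' {p} := by
      ext ρ
      exact mem_cyl_append
    rw [this]
    exact ih.inter (measurable_pi_apply _ (measurableSet_singleton p))

theorem measurableSet_cylState (h : List (Fin n × Fin m)) (s : Fin n) :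
    MeasurableSet (cylState h s) :=
  (measurableSet_cyl h).inter
    (measurable_fst.comp (measurable_pi_apply _) (measurableSet_singleton s))

theorem RatDist.toPMF_apply {α : Type} [Fintype α] (p : RatDist α) (x : α) :
    p.toPMF x = ((p.prob x : ℝ≥0) : ℝ≥0∞) := by
  simp [RatDist.toPMF]

theorem WeightedMDP.Strategy.pairLaw_apply {M : WeightedMDP n m d} (σ : M.Strategy)
    (h : List (Fin n × Fin m)) (p : PMF (Fin n)) (s : Fin n) (a : Fin m) :
    σ.pairLaw h p (s, a) = p s * (σ.act h s).toPMF a := by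
  classical
  simp only [WeightedMDP.Strategy.pairLaw, PMF.bind_apply, PMF.map_apply, tsum_fintype]
  rw [Finset.sum_eq_single s, Finset.sum_eq_single a]
  · simp
  · intro b _ hb
    simp [hb.symm]
  · simp
  · intro t _ ht
    simp [ht.symm]
  · simp

/-- The law of the state that follows the history `h`. -/
noncomputable def WeightedMDP.stateLaw (M : WeightedMDP n m d) (s₀ : Fin n)
    (h : List (Fin n × Fin m)) : PMF (Fin n) :=
  match h.getLast? with
  | none => PMF.pure s₀
  | some p => M.nextState p.1 p.2

section Measure

variable {M : WeightedMDP n m d} (σ : M.Strategy) (s₀ : Fin n)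

instance : IsProbabilityMeasure (σ.runMeasure s₀) := by
  unfold WeightedMDP.Strategy.runMeasure
  have : IsProbabilityMeasure (σ.pairLaw [] (PMF.pure s₀)).toMeasure :=
    PMF.toMeasure.isProbabilityMeasure _
  infer_instance

theorem runMeasure_cyl_singleton (p : Fin n × Fin m) :
    σ.runMeasure s₀ (cyl [p]) = σ.pairLaw [] (PMF.pure s₀) p := by
  have e : cyl [p] = Preorder.frestrictLe (π := fun _ => Fin n × Fin m) 0 ⁻¹'
      {x | x ⟨0, Finset.mem_Iic.2 le_rfl⟩ = p} := by
    ext ρ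
    simp [cyl, Run.take]
  have hm : MeasurableSet {x : Π _ : Finset.Iic 0, Fin n × Fin m |
      x ⟨0, Finset.mem_Iic.2 le_rfl⟩ = p} :=
    measurable_pi_apply (X := fun _ : Finset.Iic 0 => Fin n × Fin m) _ (measurableSet_singleton p)
  have : IsProbabilityMeasure (σ.pairLaw [] (PMF.pure s₀)).toMeasure :=
    PMF.toMeasure.isProbabilityMeasure _
  rw [e, ← Measure.map_apply (by fun_prop) hm, WeightedMDP.Strategy.runMeasure,
    Kernel.trajMeasure, Measure.map_comp _ _ (by fun_prop), Kernel.traj_map_frestrictLe,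
    Kernel.partialTraj_self, Measure.id_comp, Measure.map_apply (by fun_prop) hm]
  have e2 : (MeasurableEquiv.piUnique fun _ : Finset.Iic 0 => Fin n × Fin m).symm ⁻¹'
      {x | x ⟨0, Finset.mem_Iic.2 le_rfl⟩ = p} = {p} := by
    ext q
    simp
  rw [e2, PMF.toMeasure_apply_singleton _ _ (measurableSet_singleton p)]

/-- The joint law of the first `k + 1` pairs and the next one is the composition-product of the
trajectory marginal with `σ.kernel k`, and on the histories in question this kernel is constant. -/
theorem runMeasure_cyl_append_append (h : List (Fin n × Fin m)) (p q : Fin n × Fin m) :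
    σ.runMeasure s₀ (cyl (h ++ [p] ++ [q])) =
      σ.runMeasure s₀ (cyl (h ++ [p])) * σ.pairLaw (h ++ [p]) (M.nextState p.1 p.2) q := by
  set k := h.length
  have : IsProbabilityMeasure (σ.pairLaw [] (PMF.pure s₀)).toMeasure :=
    PMF.toMeasure.isProbabilityMeasure _
  let S : Set (Π _ : Finset.Iic k, Fin n × Fin m) :=
    {x | (List.ofFn fun i : Fin (k + 1) => x ⟨i, Finset.mem_Iic.2 (Nat.lt_succ_iff.1 i.2)⟩) =
      h ++ [p]}
  have hS : MeasurableSet S := (Set.toFinite S).measurableSet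
  have e1 : cyl (h ++ [p]) = Preorder.frestrictLe (π := fun _ => Fin n × Fin m) k ⁻¹' S := by
    ext ρ
    simp [cyl, Run.take, S, k]
  have e2 : cyl (h ++ [p] ++ [q]) =
      (fun x : Run n m => (Preorder.frestrictLe (π := fun _ => Fin n × Fin m) k x, x (k + 1))) ⁻¹'
        (S ×ˢ {q}) := by
    ext ρ
    rw [mem_cyl_append, e1]
    simp [k]
  have hlast : ∀ x ∈ S, x ⟨k, Finset.mem_Iic.2 le_rfl⟩ = p := fun x hx => by
    have hx : (List.ofFn fun i : Fin (k + 1) =>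
      x ⟨i, Finset.mem_Iic.2 (Nat.lt_succ_iff.1 i.2)⟩) = h ++ [p] := hx
    rw [List.ofFn_succ', List.concat_eq_append] at hx
    simpa using (List.append_inj' hx rfl).2
  rw [e2, ← Measure.map_apply (by fun_prop) (hS.prod (measurableSet_singleton q)), e1,
    ← Measure.map_apply (by fun_prop) hS, WeightedMDP.Strategy.runMeasure,
    ← Kernel.map_frestrictLe_trajMeasure_compProd_eq_map_trajMeasure,
    Measure.compProd_apply_prod hS (measurableSet_singleton q)]
  rw [setLIntegral_congr_fun hS (g := fun _ => σ.pairLaw (h ++ [p]) (M.nextState p.1 p.2) q),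
    setLIntegral_const, mul_comm]
  intro x hx
  have hx' : (List.ofFn fun i : Fin (k + 1) =>
    x ⟨i, Finset.mem_Iic.2 (Nat.lt_succ_iff.1 i.2)⟩) = h ++ [p] := hx
  change (σ.pairLaw (List.ofFn fun i : Fin (k + 1) =>
    x ⟨i, Finset.mem_Iic.2 (Nat.lt_succ_iff.1 i.2)⟩) (M.nextState _ _)).toMeasure {q} = _
  rw [hx', hlast x hx, PMF.toMeasure_apply_singleton _ _ (measurableSet_singleton q)]

theorem runMeasure_cyl_append (h : List (Fin n × Fin m)) (s : Fin n) (a : Fin m) :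
    σ.runMeasure s₀ (cyl (h ++ [(s, a)])) =
      σ.runMeasure s₀ (cyl h) * M.stateLaw s₀ h s * (σ.act h s).toPMF a := by
  rcases List.eq_nil_or_concat h with rfl | ⟨h', p, rfl⟩
  · simp [runMeasure_cyl_singleton, WeightedMDP.Strategy.pairLaw_apply, cyl_nil,
      WeightedMDP.stateLaw]
  · rw [List.concat_eq_append, runMeasure_cyl_append_append, WeightedMDP.Strategy.pairLaw_apply,
      mul_assoc]
    simp [WeightedMDP.stateLaw]

theorem runMeasure_cylState_inter (h : List (Fin n × Fin m)) (s : Fin n) (A : Set (Run n m)) :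
    σ.runMeasure s₀ (cylState h s ∩ A) = ∑ a, σ.runMeasure s₀ (cyl (h ++ [(s, a)]) ∩ A) := by
  have e : cylState h s = ⋃ a, cyl (h ++ [(s, a)]) := by
    ext ρ
    simp only [Set.mem_iUnion, mem_cyl_append, cylState, Set.mem_ofPred_eq, Prod.ext_iff]
    exact ⟨fun ⟨h1, h2⟩ => ⟨_, h1, h2, rfl⟩, fun ⟨a, h1, h2, _⟩ => ⟨h1, h2⟩⟩
  rw [← Measure.restrict_apply (measurableSet_cylState h s), e, measure_iUnion, tsum_fintype]
  · simp_rw [Measure.restrict_apply (measurableSet_cyl _)]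
  · refine fun a b hab => Set.disjoint_left.2 fun ρ ha hb => hab ?_
    have := (mem_cyl_append.1 ha).2.symm.trans (mem_cyl_append.1 hb).2
    simpa using this
  · exact fun a => measurableSet_cyl _

theorem runMeasure_cyl_inter (h : List (Fin n × Fin m)) (A : Set (Run n m)) :
    σ.runMeasure s₀ (cyl h ∩ A) = ∑ s, σ.runMeasure s₀ (cylState h s ∩ A) := by
  have e : cyl h = ⋃ s, cylState h s := by
    ext ρ
    simp [cylState]
  rw [← Measure.restrict_apply (measurableSet_cyl h), e, measure_iUnion, tsum_fintype]
  · simp_rw [Measure.restrict_apply (measurableSet_cylState _ _)]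
  · exact fun a b hab => Set.disjoint_left.2 fun ρ ha hb => hab (ha.2.symm.trans hb.2)
  · exact fun s => measurableSet_cylState _ _

theorem runMeasure_cylState (h : List (Fin n × Fin m)) (s : Fin n) :
    σ.runMeasure s₀ (cylState h s) = σ.runMeasure s₀ (cyl h) * M.stateLaw s₀ h s := by
  have := runMeasure_cylState_inter σ s₀ h s Set.univ
  simp only [Set.inter_univ, runMeasure_cyl_append] at this
  rw [this, ← Finset.mul_sum, ← tsum_fintype (L := .unconditional _), PMF.tsum_coe, mul_one]

end Measure

/-! ### Almost sure satisfaction -/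

/-- The accumulated weight of a history. -/
def WeightedMDP.histWeight (M : WeightedMDP n m d) (h : List (Fin n × Fin m)) : Fin d → ℤ :=
  (h.map fun p => M.weight p.2).sum

@[simp] theorem WeightedMDP.histWeight_append (M : WeightedMDP n m d)
    (h : List (Fin n × Fin m)) (p : Fin n × Fin m) :
    M.histWeight (h ++ [p]) = M.histWeight h + M.weight p.2 := by
  simp [WeightedMDP.histWeight]

theorem WeightedMDP.histWeight_take (M : WeightedMDP n m d) (ρ : Run n m) (k : ℕ) (l : Fin d) :
    M.histWeight (Run.take ρ k) l = ∑ j ∈ Finset.range k, M.weight (ρ j).2 l := by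
  induction k with
  | zero => simp [WeightedMDP.histWeight, Run.take]
  | succ k ih => rw [Run.take_succ, histWeight_append, Finset.sum_range_succ, Pi.add_apply, ih]

theorem WeightedMDP.truncatedSum_le_iff (M : WeightedMDP n m d) (T : Finset (Fin n)) (l : Fin d)
    (ρ : Run n m) :
    M.truncatedSum T l ρ ≤ ((0 : ℚ) : WithTop ℚ) ↔
      ∃ k, (ρ k).1 ∈ T ∧ (∀ j < k, (ρ j).1 ∉ T) ∧ M.histWeight (Run.take ρ k) l ≤ 0 := by
  classical
  unfold WeightedMDP.truncatedSum
  split_ifs with h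
  · rw [WithTop.coe_le_coe, Int.cast_nonpos]
    constructor
    · exact fun h' => ⟨_, Nat.find_spec h, fun j => Nat.find_min h, by rwa [histWeight_take]⟩
    · rintro ⟨k, h1, h2, h3⟩
      obtain rfl : Nat.find h = k := (Nat.find_eq_iff h).2 ⟨h1, fun j hj => h2 j hj⟩
      rwa [histWeight_take] at h3
  · simp only [top_le_iff, WithTop.coe_ne_top, false_iff, not_exists]
    exact fun k hk => h ⟨k, hk.1⟩

/-- The runs whose truncated sums are at most zero in all dimensions. -/
def WeightedMDP.good (M : WeightedMDP n m d) (T : Finset (Fin n)) : Set (Run n m) :=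
  {ρ | ∃ k, (ρ k).1 ∈ T ∧ (∀ j < k, (ρ j).1 ∉ T) ∧ M.histWeight (Run.take ρ k) ≤ 0}

/-- The query that all truncated sums are almost surely at most zero. -/
def nonposQuery (T : Finset (Fin n)) (d : ℕ) : List (Constraint n d) :=
  List.ofFn fun l => ⟨T, l, 0, 1, le_rfl⟩

theorem measurableSet_truncatedSum_le (M : WeightedMDP n m d) (T : Finset (Fin n)) (l : Fin d) :
    MeasurableSet {ρ | M.truncatedSum T l ρ ≤ ((0 : ℚ) : WithTop ℚ)} := by
  simp_rw [WeightedMDP.truncatedSum_le_iff, WeightedMDP.histWeight_take]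
  have h : ∀ (k : ℕ) (S : Set (Fin n × Fin m)), MeasurableSet {ρ : Run n m | ρ k ∈ S} :=
    fun k S => measurable_pi_apply (X := fun _ => Fin n × Fin m) k S.toFinite.measurableSet
  have hsum : ∀ k : ℕ, Measurable fun ρ : Run n m =>
      ∑ j ∈ Finset.range k, M.weight (ρ j).2 l := fun k =>
    Finset.measurable_sum _ fun j _ =>
      (measurable_of_finite fun p : Fin n × Fin m => M.weight p.2 l).comp (measurable_pi_apply j)
  have e : {ρ : Run n m | ∃ k, (ρ k).1 ∈ T ∧ (∀ j < k, (ρ j).1 ∉ T) ∧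
      ∑ j ∈ Finset.range k, M.weight (ρ j).2 l ≤ 0} =
      ⋃ k, {ρ : Run n m | ρ k ∈ {p | p.1 ∈ T}} ∩
        ((⋂ j, ⋂ _ : j < k, {ρ : Run n m | ρ j ∈ {p | p.1 ∉ T}}) ∩
          (fun ρ : Run n m => ∑ j ∈ Finset.range k, M.weight (ρ j).2 l) ⁻¹' Set.Iic 0) := by
    ext ρ
    simp
  rw [e]
  exact .iUnion fun k => (h k _).inter
    ((MeasurableSet.iInter fun j => .iInter fun _ => h j _).inter (hsum k measurableSet_Iic))

/-- Probability at least 1 means almost surely, and finitely many almost sure events can be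
intersected. The time of the first visit does not depend on the dimension, so one `k` serves all of
them. -/
theorem forall_satisfies_nonposQuery_iff [NeZero d] {M : WeightedMDP n m d} (σ : M.Strategy)
    (s₀ : Fin n) (T : Finset (Fin n)) :
    (∀ c ∈ nonposQuery T d, σ.Satisfies s₀ c) ↔ ∀ᵐ ρ ∂σ.runMeasure s₀, ρ ∈ M.good T := by
  have h1 : ∀ ρ, ρ ∈ M.good T ↔ ∀ l, M.truncatedSum T l ρ ≤ ((0 : ℚ) : WithTop ℚ) := by
    intro ρ
    simp_rw [WeightedMDP.truncatedSum_le_iff]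
    constructor
    · rintro ⟨k, h1, h2, h3⟩ l
      exact ⟨k, h1, h2, h3 l⟩
    · intro h
      -- With no dimension the query would be empty and would not force a visit of `T`.
      obtain ⟨k, h1, h2, -⟩ := h 0
      refine ⟨k, h1, h2, fun l => ?_⟩
      obtain ⟨k', h1', h2', h3⟩ := h l
      obtain rfl : k = k' := by
        rcases lt_trichotomy k k' with hk | hk | hk
        · exact absurd h1 (h2' _ hk)
        · exact hk
        · exact absurd h1' (h2 _ hk)
      exact h3
  simp_rw [h1, ae_all_iff, nonposQuery, List.forall_mem_ofFn_iff]
  refine forall_congr' fun l => ?_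
  have hm := measurableSet_truncatedSum_le M T l
  have := prob_compl_eq_zero_iff (μ := σ.runMeasure s₀) hm
  rw [ae_iff]
  change _ ↔ σ.runMeasure s₀ {ρ | M.truncatedSum T l ρ ≤ ((0 : ℚ) : WithTop ℚ)}ᶜ = 0
  rw [this, WeightedMDP.Strategy.Satisfies, measureReal_def]
  simp only [NNRat.cast_one]
  constructor
  · intro h
    refine le_antisymm prob_le_one ?_
    rwa [← ENNReal.ofReal_le_iff_le_toReal (measure_ne_top _ _), ENNReal.ofReal_one] at h
  · intro h
    rw [h]
    simp

/-! ### From strategies to winning sets -/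

/-- From `s` with accumulated weight `v`, the target can be reached with a nonpositive weight along
a path all of whose outgoing edges stay inside `P`. -/
inductive WeightedMDP.Attains (M : WeightedMDP n m d) (T : Finset (Fin n))
    (P : Set (Fin n × (Fin d → ℤ))) : Fin n → (Fin d → ℤ) → Prop
  | target {s v} : s ∈ T → v ≤ 0 → Attains M T P s v
  | step {s v a p s'} : s ∉ T → M.trans s a = some p →
      (∀ t, p.prob t ≠ 0 → (t, v + M.weight a) ∈ P) → p.prob s' ≠ 0 →
      Attains M T P s' (v + M.weight a) → Attains M T P s v

theorem WeightedMDP.stateLaw_append {M : WeightedMDP n m d} {s₀ s : Fin n} {a : Fin m}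
    {p : RatDist (Fin n)} (h : M.trans s a = some p) (l : List (Fin n × Fin m)) (t : Fin n) :
    M.stateLaw s₀ (l ++ [(s, a)]) t = ((p.prob t : ℝ≥0) : ℝ≥0∞) := by
  simp [WeightedMDP.stateLaw, WeightedMDP.nextState, h, RatDist.toPMF_apply]

/-- There are only countably many histories, so the union of the null cylinders is null. -/
theorem ae_runMeasure_cyl_take_ne_zero {M : WeightedMDP n m d} (σ : M.Strategy) (s₀ : Fin n) :
    ∀ᵐ ρ ∂σ.runMeasure s₀, ∀ k, σ.runMeasure s₀ (cyl (Run.take ρ k)) ≠ 0 := by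
  rw [ae_all_iff]
  intro k
  rw [ae_iff]
  have : {ρ : Run n m | ¬ σ.runMeasure s₀ (cyl (Run.take ρ k)) ≠ 0} ⊆
      ⋃ h ∈ {h | σ.runMeasure s₀ (cyl h) = 0}, cyl h := by
    intro ρ hρ
    simp only [Set.mem_iUnion]
    exact ⟨Run.take ρ k, by simpa using hρ, by simp [cyl]⟩
  exact measure_mono_null this ((measure_biUnion_null_iff (Set.to_countable _)).2 fun _ h => h)

theorem exists_attains_of_ae_good {M : WeightedMDP n m d} {σ : M.Strategy} {s₀ : Fin n}
    {T : Finset (Fin n)} (hσ : ∀ᵐ ρ ∂σ.runMeasure s₀, ρ ∈ M.good T) :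
    ∃ P : Set (Fin n × (Fin d → ℤ)), (s₀, 0) ∈ P ∧ ∀ c ∈ P, M.Attains T P c.1 c.2 := by
  -- `P` collects the states and weights that occur with positive probability before `T` is visited.
  -- A good run through such a history, all of whose prefixes have positive probability, supplies
  -- the path.
  let P : Set (Fin n × (Fin d → ℤ)) := {c | ∃ h, σ.runMeasure s₀ (cylState h c.1) ≠ 0 ∧
    (∀ p ∈ h, p.1 ∉ T) ∧ M.histWeight h = c.2}
  refine ⟨P, ⟨[], ?_, by simp, rfl⟩, ?_⟩
  · simp [runMeasure_cylState, cyl_nil, WeightedMDP.stateLaw]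
  rintro ⟨s, v⟩ ⟨h, hpos, hT, rfl⟩
  obtain ⟨ρ, ⟨hρ, hs⟩, ⟨K, hK, hlt, hw⟩, hcyl⟩ :
      ∃ ρ ∈ cylState h s, ρ ∈ M.good T ∧ ∀ k, σ.runMeasure s₀ (cyl (Run.take ρ k)) ≠ 0 := by
    by_contra! hcon
    refine hpos (measure_mono_null (t := {ρ | ¬ (ρ ∈ M.good T ∧
      ∀ k, σ.runMeasure s₀ (cyl (Run.take ρ k)) ≠ 0)}) (fun ρ hρ h' => ?_)
      (ae_iff.1 (hσ.and (ae_runMeasure_cyl_take_ne_zero σ s₀))))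
    obtain ⟨k, hk⟩ := hcon ρ hρ h'.1
    exact h'.2 k hk
  -- The induction runs backwards along `ρ` from the time `K` of the first visit of `T`.
  have key : ∀ j ≤ K, M.Attains T P (ρ (K - j)).1 (M.histWeight (Run.take ρ (K - j))) := by
    intro j
    induction j with
    | zero => exact fun _ => .target hK hw
    | succ j ih =>
      intro hj
      obtain ⟨i, hi, hij⟩ : ∃ i, K - (j + 1) = i ∧ K - j = i + 1 := ⟨_, rfl, by omega⟩
      have ih := ih (by omega)
      rw [hi]
      rw [hij, Run.take_succ, WeightedMDP.histWeight_append] at ih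
      have h1 := hcyl (i + 1)
      have h2 := hcyl (i + 1 + 1)
      have e : ∀ k, ρ k = ((ρ k).1, (ρ k).2) := fun k => rfl
      rw [Run.take_succ, e, runMeasure_cyl_append] at h2
      have h1' := h1
      rw [Run.take_succ, e, runMeasure_cyl_append] at h1'
      have ha : (σ.act (Run.take ρ i) (ρ i).1).prob (ρ i).2 ≠ 0 := by
        intro h0
        simp [RatDist.toPMF_apply, h0] at h1'
      have hav : (M.trans (ρ i).1 (ρ i).2).isSome := σ.support_subset _ _ _ ha
      obtain ⟨p, hp⟩ := Option.isSome_iff_exists.1 hav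
      refine .step (hlt i (by omega)) hp (fun t ht => ?_) ?_ ih
      · refine ⟨Run.take ρ (i + 1), ?_, ?_, ?_⟩
        · rw [runMeasure_cylState]
          refine mul_ne_zero h1 ?_
          rw [Run.take_succ, e, WeightedMDP.stateLaw_append hp]
          simpa using ht
        · intro q hq
          obtain ⟨r, rfl⟩ := (List.mem_ofFn' _ _).1 hq
          exact hlt r (by omega)
        · rw [Run.take_succ, WeightedMDP.histWeight_append]
      · intro h0
        rw [Run.take_succ, e i, WeightedMDP.stateLaw_append hp] at h2
        simp [h0] at h2
  -- The history `h` avoids `T`, so the first visit is not before its end.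
  have hle : h.length ≤ K := by
    by_contra! hlt'
    refine hT (ρ K) ?_ hK
    have hρ : Run.take ρ h.length = h := hρ
    rw [← hρ]
    exact (List.mem_ofFn' _ _).2 ⟨⟨K, hlt'⟩, rfl⟩
  have := key (K - h.length) (by omega)
  have hρ : Run.take ρ h.length = h := hρ
  rwa [show K - (K - h.length) = h.length by omega, hs, hρ] at this

/-! ### From winning sets to strategies -/

/-- The target is reached surely, with a nonpositive weight, when `act` is followed. -/
inductive WeightedMDP.Surely (M : WeightedMDP n m d) (T : Finset (Fin n))
    (act : Fin n → (Fin d → ℤ) → Fin m) : Fin n → (Fin d → ℤ) → Prop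
  | target {s v} : s ∈ T → v ≤ 0 → Surely M T act s v
  | step {s v p} : s ∉ T → M.trans s (act s v) = some p →
      (∀ t, p.prob t ≠ 0 → Surely M T act t (v + M.weight (act s v))) → Surely M T act s v

/-- When `act` is followed, there is surely a step which leads to a sure success with probability at
least `1/2` and to `P` otherwise. -/
inductive WeightedMDP.Halfway (M : WeightedMDP n m d) (T : Finset (Fin n))
    (act : Fin n → (Fin d → ℤ) → Fin m) (P : Set (Fin n × (Fin d → ℤ))) :
    Fin n → (Fin d → ℤ) → Prop
  | step {s v p} : s ∉ T → M.trans s (act s v) = some p →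
      (∀ t, p.prob t ≠ 0 → Halfway M T act P t (v + M.weight (act s v))) → Halfway M T act P s v
  | branch {s v p} (t : Fin n) : s ∉ T → M.trans s (act s v) = some p → 1 / 2 ≤ p.prob t →
      M.Surely T act t (v + M.weight (act s v)) →
      (∀ t', t' ≠ t → p.prob t' ≠ 0 → (t', v + M.weight (act s v)) ∈ P) → Halfway M T act P s v

/-- The distribution concentrated in one point. -/
def RatDist.dirac {α : Type} [Fintype α] [DecidableEq α] (x : α) : RatDist α where
  prob := Pi.single x 1
  sum_prob := by simp

/-- The strategy that chooses the action given by the current state and accumulated weight. -/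
def WeightedMDP.weightStrategy (M : WeightedMDP n m d) (act : Fin n → (Fin d → ℤ) → Fin m)
    (hact : ∀ s v, (M.trans s (act s v)).isSome) : M.Strategy where
  act h s := RatDist.dirac (act s (M.histWeight h))
  support_subset h s a ha := by
    obtain rfl : a = act s (M.histWeight h) := by
      by_contra hne
      simp [RatDist.dirac, hne] at ha
    exact hact _ _

section Sufficient

variable {M : WeightedMDP n m d} {act : Fin n → (Fin d → ℤ) → Fin m}
  {hact : ∀ s v, (M.trans s (act s v)).isSome} {s₀ : Fin n} {T : Finset (Fin n)}

/-- The strategy puts all its mass on one action, so the failure probability is an average over the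
successor states only. -/
theorem runMeasure_bad_le {h : List (Fin n × Fin m)} {s : Fin n} {p : RatDist (Fin n)}
    (hp : M.trans s (act s (M.histWeight h)) = some p) (K : Fin n → ℝ≥0∞)
    (hK : ∀ t, p.prob t ≠ 0 →
      (M.weightStrategy act hact).runMeasure s₀
          (cylState (h ++ [(s, act s (M.histWeight h))]) t ∩ (M.good T)ᶜ) ≤
        K t * (M.weightStrategy act hact).runMeasure s₀
          (cylState (h ++ [(s, act s (M.histWeight h))]) t)) :
    (M.weightStrategy act hact).runMeasure s₀ (cylState h s ∩ (M.good T)ᶜ) ≤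
      (∑ t, K t * ((p.prob t : ℝ≥0) : ℝ≥0∞)) *
        (M.weightStrategy act hact).runMeasure s₀ (cylState h s) := by
  set σ := M.weightStrategy act hact with hσ
  set a := act s (M.histWeight h) with ha
  have hcyl : ∀ b, σ.runMeasure s₀ (cyl (h ++ [(s, b)])) =
      if b = a then σ.runMeasure s₀ (cylState h s) else 0 := by
    intro b
    rw [runMeasure_cyl_append, runMeasure_cylState, RatDist.toPMF_apply]
    split_ifs with hb
    · subst hb
      simp [hσ, WeightedMDP.weightStrategy, RatDist.dirac, ha]
    · simp [hσ, WeightedMDP.weightStrategy, RatDist.dirac, ← ha, hb]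
  have hst : ∀ t, σ.runMeasure s₀ (cylState (h ++ [(s, a)]) t) =
      σ.runMeasure s₀ (cylState h s) * ((p.prob t : ℝ≥0) : ℝ≥0∞) := fun t => by
    rw [runMeasure_cylState, hcyl, if_pos rfl, WeightedMDP.stateLaw_append hp]
  rw [runMeasure_cylState_inter, Finset.sum_eq_single a]
  · rw [runMeasure_cyl_inter, Finset.sum_mul]
    refine Finset.sum_le_sum fun t _ => ?_
    by_cases h0 : p.prob t = 0
    · refine (measure_mono Set.inter_subset_left).trans ?_
      rw [hst]
      simp [h0]
    · refine (hK t h0).trans ?_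
      rw [hst, mul_assoc, mul_comm (σ.runMeasure s₀ _)]
  · intro b _ hb
    exact measure_mono_null Set.inter_subset_left (by rw [hcyl, if_neg hb])
  · simp

theorem runMeasure_bad_eq_zero_of_surely {s : Fin n} {v : Fin d → ℤ} (hs : M.Surely T act s v)
    {h : List (Fin n × Fin m)} (hv : M.histWeight h = v) (hT : ∀ p ∈ h, p.1 ∉ T) :
    (M.weightStrategy act hact).runMeasure s₀ (cylState h s ∩ (M.good T)ᶜ) = 0 := by
  induction hs generalizing h with
  | @target s v hs hle =>
    subst hv
    convert measure_empty (μ := (M.weightStrategy act hact).runMeasure s₀)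
    refine Set.eq_empty_of_forall_notMem ?_
    rintro ρ ⟨⟨hρ, rfl⟩, hbad⟩
    have hρ : Run.take ρ h.length = h := hρ
    refine hbad ⟨h.length, hs, fun j hj => hT _ ?_, by rwa [hρ]⟩
    rw [← hρ]
    exact (List.mem_ofFn' _ _).2 ⟨⟨j, hj⟩, rfl⟩
  | @step s v p hs hp _ ih =>
    subst hv
    have := runMeasure_bad_le (hact := hact) (s₀ := s₀) (T := T) hp 0 fun t ht => by
      rw [ih t ht (M.histWeight_append _ _) (by
        intro q hq
        rcases List.mem_append.1 hq with hq | hq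
        · exact hT q hq
        · rw [List.mem_singleton.1 hq]
          exact hs)]
      exact zero_le
    simpa using this

theorem sum_coe_prob (p : RatDist (Fin n)) : ∑ t, ((p.prob t : ℝ≥0) : ℝ≥0∞) = 1 := by
  have h : (∑ t, (p.prob t : ℝ≥0)) = 1 := by exact_mod_cast p.sum_prob
  exact_mod_cast h

/-- At the branch, at least half of the mass succeeds surely and the rest returns to `P`, where `C`
bounds the conditional failure probability. Since `C` is arbitrary, the halving can be iterated. -/
theorem runMeasure_bad_le_of_halfway {P : Set (Fin n × (Fin d → ℤ))} {C : ℝ≥0∞}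
    (hP : ∀ c ∈ P, ∀ h, M.histWeight h = c.2 → (∀ p ∈ h, p.1 ∉ T) →
      (M.weightStrategy act hact).runMeasure s₀ (cylState h c.1 ∩ (M.good T)ᶜ) ≤
        C * (M.weightStrategy act hact).runMeasure s₀ (cylState h c.1))
    {s : Fin n} {v : Fin d → ℤ} (hs : M.Halfway T act P s v)
    {h : List (Fin n × Fin m)} (hv : M.histWeight h = v) (hT : ∀ p ∈ h, p.1 ∉ T) :
    (M.weightStrategy act hact).runMeasure s₀ (cylState h s ∩ (M.good T)ᶜ) ≤
      C * 2⁻¹ * (M.weightStrategy act hact).runMeasure s₀ (cylState h s) := by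
  have hT' : ∀ {h : List (Fin n × Fin m)} {s a}, (∀ p ∈ h, p.1 ∉ T) → s ∉ T →
      ∀ p ∈ h ++ [(s, a)], p.1 ∉ T := by
    intro h s a hT hs q hq
    rcases List.mem_append.1 hq with hq | hq
    · exact hT q hq
    · rw [List.mem_singleton.1 hq]
      exact hs
  induction hs generalizing h with
  | @step s v p hs hp _ ih =>
    subst hv
    refine (runMeasure_bad_le hp (fun _ => C * 2⁻¹) fun t ht =>
      ih t ht (M.histWeight_append _ _) (hT' hT hs)).trans_eq ?_
    rw [← Finset.mul_sum, sum_coe_prob, mul_one]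
  | @branch s v p t hs hp hhalf hsure hrest =>
    subst hv
    refine (runMeasure_bad_le hp (fun t' => if t' = t then 0 else C) fun t' ht' => ?_).trans ?_
    · split_ifs with htt
      · subst htt
        rw [runMeasure_bad_eq_zero_of_surely hsure (M.histWeight_append _ _) (hT' hT hs)]
        exact zero_le
      · exact hP _ (hrest t' htt ht') _ (M.histWeight_append _ _) (hT' hT hs)
    · gcongr
      rw [← Finset.add_sum_erase _ _ (Finset.mem_univ t), if_pos rfl, zero_mul, zero_add]
      rw [Finset.sum_congr rfl (g := fun t' => C * ((p.prob t' : ℝ≥0) : ℝ≥0∞)) fun t' ht' => by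
        rw [if_neg (Finset.ne_of_mem_erase ht')], ← Finset.mul_sum]
      gcongr
      have h1 := sum_coe_prob p
      rw [← Finset.add_sum_erase _ _ (Finset.mem_univ t)] at h1
      have h2 : (2⁻¹ : ℝ≥0∞) ≤ ((p.prob t : ℝ≥0) : ℝ≥0∞) := by
        have : ((1 / 2 : ℚ≥0) : ℝ≥0) ≤ p.prob t := by exact_mod_cast hhalf
        have := ENNReal.coe_le_coe.2 this
        simpa using this
      refine ENNReal.le_of_add_le_add_left (a := 2⁻¹) (by simp) ?_
      rw [ENNReal.inv_two_add_inv_two, ← h1]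
      gcongr

theorem ae_good_of_halfway {P : Set (Fin n × (Fin d → ℤ))} (h₀ : (s₀, 0) ∈ P)
    (hP : ∀ c ∈ P, M.Halfway T act P c.1 c.2) :
    ∀ᵐ ρ ∂(M.weightStrategy act hact).runMeasure s₀, ρ ∈ M.good T := by
  have key : ∀ k : ℕ, ∀ c ∈ P, ∀ h, M.histWeight h = c.2 → (∀ p ∈ h, p.1 ∉ T) →
      (M.weightStrategy act hact).runMeasure s₀ (cylState h c.1 ∩ (M.good T)ᶜ) ≤
        2⁻¹ ^ k * (M.weightStrategy act hact).runMeasure s₀ (cylState h c.1) := by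
    intro k
    induction k with
    | zero =>
      intro c _ h _ _
      rw [pow_zero, one_mul]
      exact measure_mono Set.inter_subset_left
    | succ k ih =>
      intro c hc h hv hT
      rw [pow_succ]
      exact runMeasure_bad_le_of_halfway ih (hP c hc) hv hT
  have h1 : (M.weightStrategy act hact).runMeasure s₀ (cylState [] s₀)ᶜ = 0 := by
    rw [prob_compl_eq_zero_iff (measurableSet_cylState _ _)]
    simp [runMeasure_cylState, cyl_nil, WeightedMDP.stateLaw]
  -- The failure probability is at most `2⁻¹ ^ k` for every `k`.
  have h2 : (M.weightStrategy act hact).runMeasure s₀ (cylState [] s₀ ∩ (M.good T)ᶜ) = 0 := by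
    refine le_antisymm (ge_of_tendsto' (ENNReal.tendsto_pow_atTop_nhds_zero_of_lt_one
      (r := 2⁻¹) (by simp)) fun k => ?_) zero_le
    refine (key k _ h₀ [] rfl (by simp)).trans ?_
    exact mul_le_of_le_one_right' prob_le_one
  rw [ae_iff]
  refine measure_mono_null (fun ρ hρ => ?_) (measure_union_null h1 h2)
  by_cases h : ρ ∈ cylState [] s₀
  · exact .inr ⟨h, hρ⟩
  · exact .inl h

end Sufficient

/-! ### Arenas -/

/-- A weighted MDP in which every action belongs to one state and leads with equal probability to
one of two (possibly equal) states. -/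
structure Arena (S A C : Type) where
  src : A → S
  fst : A → S
  snd : A → S
  weight : A → C → ℤ
  src_surjective : Function.Surjective src

namespace Arena

variable {S A C : Type}

/-- The arena version of the predicates for MDPs asks for weight exactly zero at the target;
`balance` makes the two conditions agree. -/
inductive Attains (G : Arena S A C) (t : S) (Q : Set (S × (C → ℤ))) : S → (C → ℤ) → Prop
  | target : Attains G t Q t 0
  | step {s v} (a : A) (u : S) : s ≠ t → G.src a = s → (G.fst a, v + G.weight a) ∈ Q →
      (G.snd a, v + G.weight a) ∈ Q → u = G.fst a ∨ u = G.snd a →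
      Attains G t Q u (v + G.weight a) → Attains G t Q s v

inductive Surely (G : Arena S A C) (t : S) (act : S → (C → ℤ) → A) : S → (C → ℤ) → Prop
  | target : Surely G t act t 0
  | step {s v} (s' : S) : s ≠ t → G.fst (act s v) = s' → G.snd (act s v) = s' →
      Surely G t act s' (v + G.weight (act s v)) → Surely G t act s v

/-- The two outcomes of a branch have fixed roles: `fst` is the sure success, `snd` the return to
`Q`. -/
inductive Halfway (G : Arena S A C) (t : S) (act : S → (C → ℤ) → A) (Q : Set (S × (C → ℤ))) :
    S → (C → ℤ) → Prop
  | step {s v} (s' : S) : s ≠ t → G.fst (act s v) = s' → G.snd (act s v) = s' →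
      Halfway G t act Q s' (v + G.weight (act s v)) → Halfway G t act Q s v
  | branch {s v} : s ≠ t →
      Surely G t act (G.fst (act s v)) (v + G.weight (act s v)) →
      (G.snd (act s v), v + G.weight (act s v)) ∈ Q → Halfway G t act Q s v

end Arena

/-- The uniform distribution on two (possibly equal) points. -/
def RatDist.half {α : Type} [Fintype α] [DecidableEq α] (x y : α) : RatDist α where
  prob := Pi.single x (1 / 2) + Pi.single y (1 / 2)
  sum_prob := by
    simp only [Pi.add_apply, Finset.sum_add_distrib, Finset.sum_pi_single', Finset.mem_univ,
      if_true]
    norm_num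

theorem RatDist.half_prob_ne_zero_iff {α : Type} [Fintype α] [DecidableEq α] {x y z : α} :
    (RatDist.half x y).prob z ≠ 0 ↔ z = x ∨ z = y := by
  simp only [RatDist.half, Pi.add_apply, Pi.single_apply]
  split_ifs <;> simp_all

/-- An additional coordinate makes the sum of the coordinates zero. -/
def balance {C : Type} [Fintype C] (v : C → ℤ) : Option C → ℤ
  | none => -∑ c, v c
  | some c => v c

theorem balance_add {C : Type} [Fintype C] (v w : C → ℤ) :
    balance (v + w) = balance v + balance w := by
  funext i
  cases i
  · simp [balance, Finset.sum_add_distrib]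
    ring
  · rfl

/-- Nonpositive numbers whose sum is nonnegative all vanish. Upper bounds alone thus express
equalities, at the price of one dimension. -/
theorem balance_nonpos_iff {C : Type} [Fintype C] {v : C → ℤ} : balance v ≤ 0 ↔ v = 0 := by
  constructor
  · intro h
    have h1 : ∀ c, v c ≤ 0 := fun c => h (some c)
    have h2 : -∑ c, v c ≤ 0 := h none
    have h3 := (Finset.sum_eq_zero_iff_of_nonpos fun c _ => h1 c).1
      (le_antisymm (Finset.sum_nonpos fun c _ => h1 c) (by linarith))
    exact funext fun c => h3 c (Finset.mem_univ c)
  · rintro rfl i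
    cases i <;> simp [balance]

/-! ### Arenas as weighted MDPs -/

section ToMDP

variable {S A C : Type} [Fintype C] {n m d : ℕ}

open scoped Classical in
/-- The weighted MDP of an arena, with enumerated states, actions and dimensions. -/
noncomputable def Arena.toMDP (G : Arena S A C) (eS : S ≃ Fin n) (eA : A ≃ Fin m)
    (eD : Option C ≃ Fin d) : WeightedMDP n m d where
  trans s a := if G.src (eA.symm a) = eS.symm s then
    some (RatDist.half (eS (G.fst (eA.symm a))) (eS (G.snd (eA.symm a)))) else none
  deadlockFree s := by
    obtain ⟨a, ha⟩ := G.src_surjective (eS.symm s)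
    exact ⟨eA a, by simp [ha]⟩
  weight a l := balance (G.weight (eA.symm a)) (eD.symm l)

variable {G : Arena S A C} {eS : S ≃ Fin n} {eA : A ≃ Fin m} {eD : Option C ≃ Fin d}

theorem balance_comp_add (v w : C → ℤ) : balance (v + w) ∘ eD.symm =
    balance v ∘ eD.symm + balance w ∘ eD.symm := by
  rw [balance_add]
  rfl

theorem balance_comp_nonpos_iff {v : C → ℤ} : balance v ∘ eD.symm ≤ 0 ↔ v = 0 := by
  rw [← balance_nonpos_iff]
  exact ⟨fun h i => by simpa using h (eD i), fun h l => h _⟩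

theorem balance_comp_zero : balance (0 : C → ℤ) ∘ eD.symm = 0 := by
  funext l
  rcases h : eD.symm l <;> simp [balance, h]

theorem Arena.attains_of_toMDP {P : Set (Fin n × (Fin d → ℤ))} {t : S} {s' v'}
    (h : (G.toMDP eS eA eD).Attains {eS t} P s' v') {s : S} {v : C → ℤ} (hs : s' = eS s)
    (hv : v' = balance v ∘ eD.symm) :
    G.Attains t {c | (eS c.1, balance c.2 ∘ eD.symm) ∈ P} s v := by
  induction h generalizing s v with
  | target ht hle =>
    subst hs hv
    obtain rfl : s = t := by simpa using ht
    rw [balance_comp_nonpos_iff.1 hle]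
    exact .target
  | @step s' v' a p u ht hp hP hu _ ih =>
    subst hs hv
    simp only [toMDP, Equiv.symm_apply_apply] at hp
    split_ifs at hp with hsrc
    cases hp
    have hw : balance v ∘ eD.symm + (G.toMDP eS eA eD).weight a =
        balance (v + G.weight (eA.symm a)) ∘ eD.symm := (balance_comp_add _ _).symm
    rw [hw] at hP
    refine .step (eA.symm a) (eS.symm u) (by simpa using ht) (by simpa using hsrc)
      (hP _ (RatDist.half_prob_ne_zero_iff.2 (.inl rfl)))
      (hP _ (RatDist.half_prob_ne_zero_iff.2 (.inr rfl))) ?_ (ih (by simp) hw)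
    simpa only [Equiv.symm_apply_eq] using RatDist.half_prob_ne_zero_iff.1 hu

theorem Arena.exists_attains [NeZero d] {t s₀ : S} {σ : (G.toMDP eS eA eD).Strategy}
    (hσ : ∀ c ∈ nonposQuery {eS t} d, σ.Satisfies (eS s₀) c) :
    ∃ Q : Set (S × (C → ℤ)), (s₀, 0) ∈ Q ∧ ∀ c ∈ Q, G.Attains t Q c.1 c.2 := by
  obtain ⟨P, h₀, hP⟩ :=
    exists_attains_of_ae_good ((forall_satisfies_nonposQuery_iff σ _ _).1 hσ)
  refine ⟨{c | (eS c.1, balance c.2 ∘ eD.symm) ∈ P}, ?_, fun c hc =>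
    attains_of_toMDP (hP _ hc) rfl rfl⟩
  simpa [balance_comp_zero] using h₀

/-- A choice of actions, for the enumerated states and actions. -/
def Arena.actFin (act : S → (C → ℤ) → A) (eS : S ≃ Fin n) (eA : A ≃ Fin m)
    (eD : Option C ≃ Fin d) (s : Fin n) (v : Fin d → ℤ) : Fin m :=
  eA (act (eS.symm s) fun c => v (eD (some c)))

theorem Arena.actFin_apply {act : S → (C → ℤ) → A} {s : S} {v : C → ℤ} :
    actFin act eS eA eD (eS s) (balance v ∘ eD.symm) = eA (act s v) := by
  simp [actFin, balance]

variable {act : S → (C → ℤ) → A}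

open scoped Classical in
theorem Arena.toMDP_trans_actFin (hact : ∀ s v, G.src (act s v) = s) (s : S) (v : C → ℤ) :
    (G.toMDP eS eA eD).trans (eS s) (actFin act eS eA eD (eS s) (balance v ∘ eD.symm)) =
      some (RatDist.half (eS (G.fst (act s v))) (eS (G.snd (act s v)))) := by
  simp [actFin_apply, toMDP, hact]

theorem Arena.toMDP_weight_actFin (s : S) (v : C → ℤ) :
    balance v ∘ eD.symm + (G.toMDP eS eA eD).weight
      (actFin act eS eA eD (eS s) (balance v ∘ eD.symm)) =
      balance (v + G.weight (act s v)) ∘ eD.symm := by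
  rw [balance_comp_add, actFin_apply]
  congr 1
  simp [toMDP]
  rfl

theorem Arena.Surely.toMDP {t s : S} {v : C → ℤ} (hact : ∀ s v, G.src (act s v) = s)
    (h : G.Surely t act s v) : (G.toMDP eS eA eD).Surely {eS t} (actFin act eS eA eD) (eS s)
      (balance v ∘ eD.symm) := by
  induction h with
  | target => exact .target (by simp) (by rw [balance_comp_zero])
  | @step s v s' hs h1 h2 _ ih =>
    refine .step (by simpa using hs) (toMDP_trans_actFin hact s v) fun u hu => ?_
    rw [RatDist.half_prob_ne_zero_iff, h1, h2, or_self] at hu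
    rw [toMDP_weight_actFin, hu]
    exact ih

theorem Arena.Halfway.toMDP {t s : S} {v : C → ℤ} (hact : ∀ s v, G.src (act s v) = s)
    {Q : Set (S × (C → ℤ))} (h : G.Halfway t act Q s v) :
    (G.toMDP eS eA eD).Halfway {eS t} (actFin act eS eA eD)
      ((fun c => (eS c.1, balance c.2 ∘ eD.symm)) '' Q) (eS s) (balance v ∘ eD.symm) := by
  induction h with
  | @step s v s' hs h1 h2 _ ih =>
    refine .step (by simpa using hs) (toMDP_trans_actFin hact s v) fun u hu => ?_
    rw [RatDist.half_prob_ne_zero_iff, h1, h2, or_self] at hu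
    rw [toMDP_weight_actFin, hu]
    exact ih
  | @branch s v hs hsure hQ =>
    refine .branch (eS (G.fst (act s v))) (by simpa using hs) (toMDP_trans_actFin hact s v) ?_ ?_ ?_
    · simp [RatDist.half]
    · rw [toMDP_weight_actFin]
      exact hsure.toMDP hact
    · intro u hu1 hu2
      rw [RatDist.half_prob_ne_zero_iff] at hu2
      rw [toMDP_weight_actFin, hu2.resolve_left hu1]
      exact ⟨_, hQ, rfl⟩

theorem Arena.exists_satisfies [NeZero d] {t s₀ : S} (hact : ∀ s v, G.src (act s v) = s)
    {Q : Set (S × (C → ℤ))} (h₀ : (s₀, 0) ∈ Q) (hQ : ∀ c ∈ Q, G.Halfway t act Q c.1 c.2) :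
    ∃ σ : (G.toMDP eS eA eD).Strategy, ∀ c ∈ nonposQuery {eS t} d, σ.Satisfies (eS s₀) c := by
  classical
  have hact' : ∀ s v, ((G.toMDP eS eA eD).trans s (actFin act eS eA eD s v)).isSome := by
    intro s v
    simp [actFin, toMDP, hact]
  refine ⟨WeightedMDP.weightStrategy _ _ hact', (forall_satisfies_nonposQuery_iff _ _ _).2
    (ae_good_of_halfway (P := (fun c => (eS c.1, balance c.2 ∘ eD.symm)) '' Q)
      ⟨_, h₀, by simp [balance_comp_zero]⟩ ?_)⟩
  rintro _ ⟨c, hc, rfl⟩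
  exact (hQ c hc).toMDP hact

end ToMDP

/-! ### The arena of a loop program -/

inductive LoopState (N R C : Type) : Type
  | node (p : N)
  | loop (r : R)
  | check (i : C)
  | target

inductive LoopAction (N R C : Type) : Type
  | stay (s : LoopState N R C)
  | enter (r : R)
  | iter (r : R)
  | exit (r : R)
  | incr (i j : C)
  | decr (i j : C)
  | done (i : C)

instance {N R C : Type} [Finite N] [Finite R] [Finite C] : Finite (LoopState N R C) :=
  Finite.of_injective (β := Option (N ⊕ R ⊕ C))
    (fun
      | .node p => some (.inl p)
      | .loop r => some (.inr (.inl r))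
      | .check i => some (.inr (.inr i))
      | .target => none)
    fun x y => by cases x <;> cases y <;> simp

instance {N R C : Type} [Finite N] [Finite R] [Finite C] : Finite (LoopAction N R C) :=
  Finite.of_injective (β := LoopState N R C ⊕ R ⊕ R ⊕ R ⊕ C × C ⊕ C × C ⊕ C)
    (fun
      | .stay s => .inl s
      | .enter r => .inr (.inl r)
      | .iter r => .inr (.inr (.inl r))
      | .exit r => .inr (.inr (.inr (.inl r)))
      | .incr i j => .inr (.inr (.inr (.inr (.inl (i, j)))))
      | .decr i j => .inr (.inr (.inr (.inr (.inr (.inl (i, j))))))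
      | .done i => .inr (.inr (.inr (.inr (.inr (.inr i))))))
    fun x y => by cases x <;> cases y <;> simp

section LoopArena

variable {N R C : Type} [DecidableEq C]

/-- The arena of a loop program. A loop is left with a random choice between the continuation of the
program and a check that the tested counter is zero: there, all other counters can be changed. -/
def LoopProgram.arena (P : LoopProgram N R C) : Arena (LoopState N R C) (LoopAction N R C) C where
  src
    | .stay s => s
    | .enter r => .node (P.src r)
    | .iter r => .loop r
    | .exit r => .loop r
    | .incr i _ => .check i
    | .decr i _ => .check i
    | .done i => .check i
  fst
    | .stay s => s
    | .enter r => .loop r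
    | .iter r => .loop r
    | .exit r => .check (P.test r)
    | .incr i _ => .check i
    | .decr i _ => .check i
    | .done _ => .target
  snd
    | .stay s => s
    | .enter r => .loop r
    | .iter r => .loop r
    | .exit r => .node (P.dst r)
    | .incr i _ => .check i
    | .decr i _ => .check i
    | .done _ => .target
  weight
    | .enter r => P.pre r
    | .iter r => P.body r
    | .incr i j => if j = i then 0 else Pi.single j 1
    | .decr i j => if j = i then 0 else -Pi.single j 1
    | _ => 0
  src_surjective s := ⟨.stay s, rfl⟩

variable {P : LoopProgram N R C} {Q : Set (LoopState N R C × (C → ℤ))}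

/-- No action of `.check i` changes the counter `i`, and the target has to be reached with all
counters zero. -/
theorem LoopProgram.eq_zero_of_attains_check {s : LoopState N R C} {v : C → ℤ}
    (h : P.arena.Attains .target Q s v) {i : C} (hs : s = .check i ∨ s = .target) : v i = 0 := by
  induction h with
  | target => rfl
  | @step s v a u hne hsrc h1 h2 hu hatt ih =>
    clear hatt h1 h2
    obtain rfl := hs.resolve_right hne
    cases a <;> simp only [arena, reduceCtorEq, LoopState.check.injEq, or_self] at hsrc hu ih <;>
      subst hu
    case stay => simpa [hsrc] using ih
    case incr k j =>
      subst hsrc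
      by_cases h : j = k <;> simpa [h, eq_comm (a := k)] using ih
    case decr k j =>
      subst hsrc
      by_cases h : j = k <;> simpa [h, eq_comm (a := k)] using ih
    case done => simpa using ih

/-- The attaining path is finite, so it cannot iterate a loop forever and has to leave it. Nodes and
loops are treated in one induction because a path from a node continues inside a loop. -/
theorem LoopProgram.exists_step_of_attains (hQ : ∀ c ∈ Q, P.arena.Attains .target Q c.1 c.2)
    {s : LoopState N R C} {v : C → ℤ} (h : P.arena.Attains .target Q s v) :
    (∀ p, s = .node p → ∃ c', P.Step (p, v) c' ∧ (.node c'.1, c'.2) ∈ Q) ∧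
    (∀ r, s = .loop r → ∃ k : ℕ, (.node (P.dst r), v + k • P.body r) ∈ Q ∧
      (v + k • P.body r) (P.test r) = 0) := by
  induction h with
  | target => simp
  | @step s v a u hne hsrc h1 h2 hu hatt ih =>
    clear hatt
    cases a <;> simp only [arena, or_self] at hsrc h1 h2 hu ih <;> subst hsrc
    case stay => simpa [hu] using ih
    case enter r =>
      subst hu
      simp only [ reduceCtorEq, false_imp_iff, implies_true, and_true, true_and,
        LoopState.node.injEq, forall_eq', LoopState.loop.injEq] at ih ⊢
      obtain ⟨k, hk, h0⟩ := ih
      exact ⟨(P.dst r, v + P.pre r + k • P.body r), ⟨r, k, rfl, rfl, rfl, h0⟩, hk⟩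
    case iter r =>
      subst hu
      simp only [ reduceCtorEq, false_imp_iff, implies_true, true_and,
        forall_eq', LoopState.loop.injEq] at ih ⊢
      obtain ⟨k, hk, h0⟩ := ih
      have e : v + P.body r + k • P.body r = v + (k + 1) • P.body r := by
        rw [add_smul, one_smul, add_assoc, add_comm (P.body r)]
      rw [e] at hk h0
      exact ⟨k + 1, hk, h0⟩
    case exit r =>
      simp only [reduceCtorEq, false_imp_iff, implies_true, true_and,
        forall_eq', LoopState.loop.injEq]
      refine ⟨0, by simpa using h2, ?_⟩
      -- Whichever outcome the path takes, both outcomes of the exit lie in `Q`: the check outcome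
      -- proves that the test is passed, the other one gives the next configuration.
      simpa using eq_zero_of_attains_check (hQ _ h1) (.inl rfl)
    all_goals simp

theorem LoopProgram.diverges_of_attains {p₀ : N} (h₀ : (.node p₀, 0) ∈ Q)
    (hQ : ∀ c ∈ Q, P.arena.Attains .target Q c.1 c.2) : P.Diverges (p₀, 0) := by
  refine ⟨{c | (LoopState.node c.1, c.2) ∈ Q}, h₀, fun c hc => ?_⟩
  obtain ⟨c', hc', h⟩ := (exists_step_of_attains hQ (hQ _ hc)).1 _ rfl
  exact ⟨c', h, hc'⟩

open scoped Classical in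
/-- The choice of actions that follows an infinite computation, whose configurations are in `X`. -/
noncomputable def LoopProgram.loopAct (P : LoopProgram N R C) (X : Set (N × (C → ℤ))) :
    LoopState N R C → (C → ℤ) → LoopAction N R C
  | .node p, v => if h : ∃ r, P.src r = p ∧ ∃ k : ℕ, (P.dst r, v + P.pre r + k • P.body r) ∈ X ∧
      (v + P.pre r + k • P.body r) (P.test r) = 0 then .enter h.choose else .stay (.node p)
  | .loop r, v => if (P.dst r, v) ∈ X ∧ v (P.test r) = 0 then .exit r else .iter r
  | .check i, v => if h : ∃ j, j ≠ i ∧ v j ≠ 0 then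
      (if 0 < v h.choose then .decr i h.choose else .incr i h.choose) else .done i
  | .target, _ => .stay .target

theorem LoopProgram.src_loopAct (X : Set (N × (C → ℤ))) (s : LoopState N R C) (v : C → ℤ) :
    P.arena.src (P.loopAct X s v) = s := by
  rcases s with p | r | i | _
  · simp only [loopAct]
    split_ifs with h
    · simp [arena, h.choose_spec.1]
    · rfl
  · simp only [loopAct]
    split_ifs <;> rfl
  · simp only [loopAct]
    split_ifs <;> rfl
  · rfl

/-- Each chosen action brings one nonzero counter closer to 0, so the sum of the absolute values
decreases until `.done` is chosen. -/
theorem LoopProgram.surely_check [Fintype C] (X : Set (N × (C → ℤ))) {i : C} {v : C → ℤ}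
    (hv : v i = 0) : P.arena.Surely .target (P.loopAct X) (.check i) v := by
  induction hk : ∑ j, (v j).natAbs using Nat.strong_induction_on generalizing v with
  | _ k ih =>
    by_cases h : ∃ j, j ≠ i ∧ v j ≠ 0
    · set j := h.choose with hj
      have hji : j ≠ i := h.choose_spec.1
      have hvj : v j ≠ 0 := h.choose_spec.2
      have hlt : ∀ w : C → ℤ, (∀ l, l ≠ j → w l = v l) → (w j).natAbs < (v j).natAbs →
          ∑ l, (w l).natAbs < k := by
        intro w hw hwj
        rw [← hk]
        refine Finset.sum_lt_sum (fun l _ => ?_) ⟨j, Finset.mem_univ j, hwj⟩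
        by_cases hl : l = j
        · rw [hl]; exact hwj.le
        · rw [hw l hl]
      by_cases hpos : 0 < v j
      · have hact : P.loopAct X (.check i) v = .decr i j := by
          simp only [loopAct, dif_pos h]
          exact if_pos hpos
        refine .step (.check i) (by simp) (by rw [hact]; rfl) (by rw [hact]; rfl) ?_
        rw [hact]
        simp only [arena, if_neg hji]
        refine ih _ (hlt _ (fun l hl => by simp [hl]) ?_) (by simp [hv, hji.symm]) rfl
        simp
        omega
      · have hact : P.loopAct X (.check i) v = .incr i j := by
          simp only [loopAct, dif_pos h]
          exact if_neg hpos
        refine .step (.check i) (by simp) (by rw [hact]; rfl) (by rw [hact]; rfl) ?_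
        rw [hact]
        simp only [arena, if_neg hji]
        refine ih _ (hlt _ (fun l hl => by simp [hl]) ?_) (by simp [hv, hji.symm]) rfl
        simp
        omega
    · have hact : P.loopAct X (.check i) v = .done i := by
        simp only [loopAct, dif_neg h]
      refine .step .target (by simp) (by rw [hact]; rfl) (by rw [hact]; rfl) ?_
      have hv0 : v + P.arena.weight (P.loopAct X (.check i) v) = 0 := by
        rw [hact]
        funext j
        by_cases hj : j = i
        · simp [arena, hj, hv]
        · by_contra hne
          exact h ⟨j, hj, by simpa [arena] using hne⟩
      rw [hv0]
      exact .target

theorem LoopProgram.halfway_loop [Fintype C] (X : Set (N × (C → ℤ))) {r : R} {k : ℕ} {v : C → ℤ}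
    (hX : (P.dst r, v + k • P.body r) ∈ X) (h0 : (v + k • P.body r) (P.test r) = 0) :
    P.arena.Halfway .target (P.loopAct X) {c | ∃ p, c.1 = .node p ∧ (p, c.2) ∈ X} (.loop r) v := by
  induction k generalizing v with
  | zero =>
    rw [zero_smul, add_zero] at hX h0
    have hact : P.loopAct X (.loop r) v = .exit r := by
      simp only [loopAct]
      exact if_pos ⟨hX, h0⟩
    have hw : v + P.arena.weight (.exit r) = v := add_zero v
    refine .branch (by simp) ?_ ?_
    · rw [hact, hw]
      exact surely_check X h0
    · rw [hact, hw]
      exact ⟨_, rfl, hX⟩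
  | succ k ih =>
    -- `loopAct` does not remember `k`; it exits at the first opportunity, possibly earlier, and the
    -- resulting configuration is in `X` all the same.
    by_cases h : (P.dst r, v) ∈ X ∧ v (P.test r) = 0
    · have hact : P.loopAct X (.loop r) v = .exit r := by
        simp only [loopAct]
        exact if_pos h
      have hw : v + P.arena.weight (.exit r) = v := add_zero v
      refine .branch (by simp) ?_ ?_
      · rw [hact, hw]
        exact surely_check X h.2
      · rw [hact, hw]
        exact ⟨_, rfl, h.1⟩
    · have hact : P.loopAct X (.loop r) v = .iter r := by
        simp only [loopAct]
        exact if_neg h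
      refine .step (.loop r) (by simp) (by rw [hact]; rfl) (by rw [hact]; rfl) ?_
      rw [hact]
      have e : v + (k + 1) • P.body r = v + P.body r + k • P.body r := by
        rw [add_smul, one_smul, add_assoc, add_comm (P.body r)]
      rw [e] at hX h0
      exact ih hX h0

theorem LoopProgram.halfway_node [Fintype C] {X : Set (N × (C → ℤ))}
    (hX : ∀ c ∈ X, ∃ c' ∈ X, P.Step c c') {p : N} {v : C → ℤ} (h : (p, v) ∈ X) :
    P.arena.Halfway .target (P.loopAct X) {c | ∃ p, c.1 = .node p ∧ (p, c.2) ∈ X} (.node p) v := by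
  have hex : ∃ r, P.src r = p ∧ ∃ k : ℕ, (P.dst r, v + P.pre r + k • P.body r) ∈ X ∧
      (v + P.pre r + k • P.body r) (P.test r) = 0 := by
    obtain ⟨⟨p', v'⟩, hc', r, k, h1, h2, h3, h4⟩ := hX _ h
    simp only at h1 h2 h3 h4
    subst h2 h3
    exact ⟨r, h1, k, hc', h4⟩
  have hact : P.loopAct X (.node p) v = .enter hex.choose := by
    simp only [loopAct]
    exact dif_pos hex
  obtain ⟨-, k, h1, h2⟩ := hex.choose_spec
  refine .step (.loop hex.choose) (by simp) (by rw [hact]; rfl) (by rw [hact]; rfl) ?_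
  rw [hact]
  exact halfway_loop X h1 h2

theorem LoopProgram.exists_satisfies_iff_diverges [Fintype C] {n m d : ℕ} [NeZero d]
    {eS : LoopState N R C ≃ Fin n} {eA : LoopAction N R C ≃ Fin m} {eD : Option C ≃ Fin d}
    {p₀ : N} :
    (∃ σ : (P.arena.toMDP eS eA eD).Strategy,
      ∀ c ∈ nonposQuery {eS .target} d, σ.Satisfies (eS (.node p₀)) c) ↔ P.Diverges (p₀, 0) := by
  constructor
  · rintro ⟨σ, hσ⟩
    obtain ⟨Q, h₀, hQ⟩ := Arena.exists_attains hσ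
    exact diverges_of_attains h₀ hQ
  · rintro ⟨X, h₀, hX⟩
    refine Arena.exists_satisfies (act := P.loopAct X) (src_loopAct X)
      (Q := {c | ∃ p, c.1 = .node p ∧ (p, c.2) ∈ X}) ⟨_, rfl, h₀⟩ ?_
    rintro ⟨s, v⟩ ⟨p, hs, hp⟩
    simp only at hs hp
    subst hs
    exact halfway_node hX hp

end LoopArena

/-! ### Undecidability -/

/-- The instance whose query asks for an almost sure visit of the target state of the arena of a
loop program with all counters zero. -/
noncomputable def LoopProgram.toInstance {N R C : Type} [DecidableEq C] [Fintype C] {n m d : ℕ}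
    (P : LoopProgram N R C) (eS : LoopState N R C ≃ Fin n) (eA : LoopAction N R C ≃ Fin m)
    (eD : Option C ≃ Fin d) (p₀ : N) : Instance where
  numStates := n
  numActions := m
  numDims := d
  mdp := P.arena.toMDP eS eA eD
  init := eS (.node p₀)
  query := nonposQuery {eS .target} d

theorem LoopProgram.toInstance_hasBothSigns {N R C : Type} [DecidableEq C] [Fintype C]
    [Nontrivial C] {n m d : ℕ} (P : LoopProgram N R C) (eS : LoopState N R C ≃ Fin n)
    (eA : LoopAction N R C ≃ Fin m) (eD : Option C ≃ Fin d) (p₀ : N) :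
    (P.toInstance eS eA eD p₀).HasBothSigns := by
  obtain ⟨i, j, hij⟩ := exists_pair_ne C
  exact ⟨⟨eA (.incr i j), eD (some j), by
      simp [toInstance, Arena.toMDP, arena, balance, hij.symm]⟩,
    ⟨eA (.decr i j), eD (some j), by
      simp [toInstance, Arena.toMDP, arena, balance, hij.symm]⟩⟩

theorem LoopProgram.toInstance_uniqueTarget {N R C : Type} [DecidableEq C] [Fintype C]
    {n m d : ℕ} (P : LoopProgram N R C) (eS : LoopState N R C ≃ Fin n)
    (eA : LoopAction N R C ≃ Fin m) (eD : Option C ≃ Fin d) (p₀ : N) :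
    (P.toInstance eS eA eD p₀).UniqueTarget :=
  ⟨{eS .target}, by
    change ∀ c ∈ nonposQuery {eS .target} d, c.target = {eS .target}
    simp [nonposQuery]⟩

/-! ### Computability of the reduction and the halting problem -/

theorem computable_natCast_int {f : ℕ → ℕ} (hf : Computable f) :
    Computable fun k => (f k : ℤ) :=
  Computable.encode_iff.1
    ((Primrec.nat_mul.to_comp.comp (Computable.const 2) hf).of_eq fun _ => rfl)

/-- The integer `-n` is encoded by `2 * n - 1`; truncated subtraction also gives the right code 0
for `n = 0`. -/
theorem computable_neg_natCast_int {f : ℕ → ℕ} (hf : Computable f) :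
    Computable fun k => -(f k : ℤ) := by
  refine Computable.encode_iff.1 ((Primrec.nat_sub.to_comp.comp
    (Primrec.nat_mul.to_comp.comp (Computable.const 2) hf) (Computable.const 1)).of_eq fun k => ?_)
  rcases f k with _ | n
  · rfl
  · rfl

theorem computable_code_tapeProgram {Γ Λ : Type} [Inhabited Λ] (M : TM0.Machine Γ Λ) (B : ℕ)
    (e : Γ → ℕ) (a₀ : Γ) {g : ℕ → ℕ} (hg : Computable g) {n m d : ℕ}
    (eS : LoopState (TapeNode Γ Λ) (TapeRule Γ Λ) (Option Dir) ≃ Fin n)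
    (eA : LoopAction (TapeNode Γ Λ) (TapeRule Γ Λ) (Option Dir) ≃ Fin m)
    (eD : Option (Option Dir) ≃ Fin d) :
    Computable fun k => ((tapeProgram M B e a₀ (g k)).toInstance eS eA eD .start).code := by
  have hw : ∀ x i, Computable fun k =>
      balance ((tapeProgram M B e a₀ (g k)).arena.weight x) i := by
    -- The input enters only the action that executes the start rule: it is the weight of the right
    -- half-tape and, negated, that of the balancing coordinate.
    have hconst : ∀ x : LoopAction (TapeNode Γ Λ) (TapeRule Γ Λ) (Option Dir),
        x ≠ .enter .start → ∀ k, (tapeProgram M B e a₀ k).arena.weight x =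
          (tapeProgram M B e a₀ 0).arena.weight x := by
      intro x hx k
      rcases x with _ | r | _ | _ | _ | _ | _
      case enter => cases r <;> first | rfl | exact absurd rfl hx
      all_goals rfl
    intro x i
    by_cases hx : x = .enter .start
    · subst hx
      rcases i with _ | _ | _ | _
      · refine (computable_neg_natCast_int hg).of_eq fun k => ?_
        have h : ∀ v : Option Dir → ℤ, ∑ c, v c = v none + (v (some .left) + v (some .right)) :=
          fun v => by
            rw [Fintype.sum_option]
            congr 1
            exact Finset.sum_pair (by simp)
        simp [balance, LoopProgram.arena, h, tapeProgram, tapeVec]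
      · exact (Computable.const 0).of_eq fun k => rfl
      · exact (Computable.const 0).of_eq fun k => rfl
      · exact (computable_natCast_int hg).of_eq fun k => rfl
    · exact (Computable.const _).of_eq fun k => by rw [hconst x hx]
  have hI : Computable fun k => List.ofFn fun a => List.ofFn
      ((tapeProgram M B e a₀ (g k)).arena.toMDP eS eA eD |>.weight a) :=
    Computable.list_ofFn fun a => Computable.list_ofFn fun l => hw _ _
  exact ((Computable.const (n, m, d)).pair ((Computable.const
    (((tapeProgram M B e a₀ 0).toInstance eS eA eD .start).code.2.1)).pair (hI.pair
      ((Computable.const ((eS (.node .start) : Fin n) : ℕ)).pair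
        (Computable.const ((nonposQuery {eS .target} d).map Constraint.code)))))).of_eq fun k => rfl

theorem exists_instances_of_partrec {f : ℕ →. ℕ} (hf : Partrec f) :
    ∃ I : ℕ → Instance, Computable (fun k => (I k).code) ∧ ∀ k, (I k).numDims = 4 ∧
      (I k).HasBothSigns ∧ (I k).UniqueTarget ∧ ((I k).Satisfiable ↔ ¬ (f k).Dom) := by
  obtain ⟨Γ, Λ, _, _, _, _, M, a, b, c, hM⟩ := exists_TM0_of_partrec hf
  obtain ⟨B, ⟨e₀⟩⟩ := Finite.exists_equiv_fin Γ
  have hB : NeZero B := ⟨by rintro rfl; exact (e₀ default).elim0⟩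
  -- The blank has to be the digit 0, so that the infinite blank part of the tape is coded by
  -- leading zeros.
  let e₁ : Γ ≃ Fin B := e₀.trans (Equiv.swap (e₀ default) 0)
  let e : Γ → ℕ := fun x => e₁ x
  have he : ∀ x, e x < B := fun x => (e₁ x).2
  have hinj : Function.Injective e := Fin.val_injective.comp e₁.injective
  have h0 : e default = 0 := by simp [e, e₁]
  -- This number codes the tape to the right of the initial head symbol `a`: lowest digit `b`, then
  -- `k` digits `c`.
  let g : ℕ → ℕ := fun k => B * (Nat.rec 0 (fun _ x => B * x + e c) k : ℕ) + e b
  have hg : Computable g := by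
    have h : Primrec fun k : ℕ => (Nat.rec 0 (fun _ x => B * x + e c) k : ℕ) :=
      Primrec.nat_rec₁ (f := fun _ x => B * x + e c) 0
        (Primrec.nat_add.comp (Primrec.nat_mul.comp (Primrec.const B) Primrec.snd)
          (Primrec.const (e c))).to₂
    exact (Primrec.nat_add.comp (Primrec.nat_mul.comp (Primrec.const B) h)
      (Primrec.const (e b))).to_comp
  have hcode : ∀ k, IsCode B e (g k) (ListBlank.mk (b :: List.replicate k c)) := by
    intro k
    rw [← ListBlank.cons_mk]
    refine IsCode.cons ?_ he b
    induction k with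
    | zero => exact IsCode.nil h0
    | succ k ih =>
      rw [List.replicate_succ, ← ListBlank.cons_mk]
      exact ih.cons he c
  let eS := Finite.equivFin (LoopState (TapeNode Γ Λ) (TapeRule Γ Λ) (Option Dir))
  let eA := Finite.equivFin (LoopAction (TapeNode Γ Λ) (TapeRule Γ Λ) (Option Dir))
  let eD : Option (Option Dir) ≃ Fin 4 := Fintype.equivFinOfCardEq rfl
  refine ⟨fun k => (tapeProgram M B e a (g k)).toInstance eS eA eD .start,
    computable_code_tapeProgram M B e a hg eS eA eD, fun k => ⟨rfl,
      LoopProgram.toInstance_hasBothSigns _ _ _ _ _, LoopProgram.toInstance_uniqueTarget _ _ _ _ _,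
      ?_⟩⟩
  exact (LoopProgram.exists_satisfies_iff_diverges (d := 4) (eS := eS) (eA := eA) (eD := eD)).trans
    ((diverges_tapeProgram_iff he hinj h0 (hcode k)).trans (not_congr (hM k)))

theorem not_decidableOn {C : Set Instance}
    (hC : ∀ I : Instance, I.numDims = 4 → I.HasBothSigns → I.UniqueTarget → I ∈ C) :
    ¬ DecidableOn C := by
  rintro ⟨f, hf, hfC⟩
  have hpart : Partrec fun k : ℕ =>
      Nat.Partrec.Code.eval (Denumerable.ofNat Nat.Partrec.Code k) 0 :=
    Nat.Partrec.Code.eval_part.comp (Computable.ofNat _) (Computable.const 0)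
  obtain ⟨I, hcomp, hI⟩ := exists_instances_of_partrec hpart
  -- Satisfiability means divergence, so the negated answer decides whether a code halts on input 0.
  refine ComputablePred.halting_problem 0 (ComputablePred.computable_iff.2
    ⟨fun c => !f (I (Encodable.encode c)).code,
      Primrec.not.to_comp.comp (hf.comp (hcomp.comp Computable.encode)), ?_⟩)
  funext c
  obtain ⟨h1, h2, h3, h4⟩ := hI (Encodable.encode c)
  have := (hfC _ (hC _ h1 h2 h3)).trans h4
  rw [Denumerable.ofNat_encode] at this
  simp only [Bool.not_eq_true', ← Bool.not_eq_true, this, not_not]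

end PercentileMDP

/-- The multi-dimensional percentile problem for the truncated sum is undecidable for MDPs with both
positive and negative weights, already with four dimensions and a unique target set. -/
theorem mainTheorem3 :
    ¬ PercentileMDP.DecidableOn {I | 1 < I.numDims ∧ I.HasBothSigns} ∧
    ¬ PercentileMDP.DecidableOn {I | I.numDims = 4 ∧ I.HasBothSigns ∧ I.UniqueTarget} :=
  ⟨PercentileMDP.not_decidableOn fun _ h1 h2 _ => ⟨by rw [h1]; norm_num, h2⟩,
    PercentileMDP.not_decidableOn fun _ h1 h2 h3 => ⟨h1, h2, h3⟩⟩
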